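/- **Setting.** $G=(V,E)$ is a finite simple unweighted graph, $n=|V|$, $\log=\log_2$, and $\mathrm{cap}$ counts edges. $G'$ is the subdivision graph, with vertex set $V'=V\cup\{x_e: e\in E\}$ and edges $(x_e,v)$ for $v\in e$; for $F\subseteq E$ let $X_F=\{x_e:e\in F\}$. For $S\subseteq V$ let $S'=S\cup\{x_e: e\cap S\neq\emptyset\}$, and write $B_S=E(S,V\setminus S)$. *Demand.* For a demand matrix $Q\in\mathbb R_{\ge0}^{U\times U}$, $\mathrm{dem}_Q(A,\bar A)=\sum_{u\in A,v\notin A}(Q(u,v)+Q(v,u))$. A demand state with finite commodity set $\mathcal K$ is $P\in\mathbb R^{U\times\mathcal K}$; $\mathrm{dem}_P(A,\bar A)=\sum_k|\sum_{u\in A}P(u,k)|$, and $P$ is valid if $\sum_uP(u,k)=0$ for all $k$. A (weighted) graph $\gamma$-respects $Q$ (or $P$) if $\mathrm{cap}(A,\bar A)\ge\gamma\cdot\mathrm{dem}(A,\bar A)$ for every cut of positive demand. The all-to-all problem on $X$ is $Q(u,v)=1/|X|$ for $u,v\in X$ and $0$ otherwise. A set $X$ $\gamma$-expands in a graph if $\mathrm{cap}(A,\bar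 A)\ge\gamma\min(|X\cap A|,|X\setminus A|)$ for every vertex set $A$ with positive minimum. A flow from $X$ to $Z$ is a multi-commodity flow with one commodity per source vertex; its congestion is the maximum total flow over an edge. *Tree.* $T$ is a hierarchical decomposition of $V$ (a laminar family of non-empty clusters with root $V$ and leaves $\{v\}$), viewed as a weighted tree in which the edge from $C$ to its parent has capacity $\mathrm{cap}_G(C,V\setminus C)$. $P$ is a valid demand state on $V$ that is $1$-respected by $T$ (the demand of $v$ resides at the leaf $\{v\}$). *Invariant.* For $S\subseteq V$, a demand state $P_{S'}$ on $G'$ satisfies the invariant for $S$ with load $\alpha$ if it is zero outside $X_{B_S}$, $\sum_{x\in S'}P_{S'}(x,k)=\sum_{v\in S}P(v,k)$ for every $k$, and $\|P_{S'}(x)\|_1\le\alpha$ for every $x\in S'$. *Merge phase on $S$ with $\tau=1$* (constant $a_1>0$). It outputs a partition of $S$ into connected sets $Z_1,\dots,Z_z$ with $|Z_i|\le\frac23|S|$ and a set $Y$ of edges incident to $S$ such that, with $F$ the set of edges between different $Z_i$: $X_F$ $\frac{a_1}{\log n}$-expands in the subdivision graph of $G[S]$; in $G'[S']$ there are a flow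 from $X_Y$ to $X_{B_S}$ and a flow from $X_Y$ to $X_F$, each with congestion $2$, in which every node of $X_Y$ sends one unit and every target receives at most $2$ units; and every path in $G'[S']$ from $X_F$ to $X_{B_S}$ contains a node of $X_Y$. $R$ is the set of vertices of $S$ that can reach $X_{B_S}\setminus X_Y$ in $G'[S']\setminus X_Y$, and $L=S\setminus R$. The merge-phase sub-clusters $S_1,\dots,S_t$ are the non-empty sets among $L\cap Z_i$ and $R\cap Z_i$. *Refinement phase on $S_i$ with $\sigma=|S|$* (constants $c_f\ge1$, $a_2,b,d>0$). It outputs a partition of $S_i$ into $S_{i,1},\dots,S_{i,t_i}$ such that, with $f(S_{i,j})=c_f\log\!\left(\frac{|S|}{|S_{i,j}|}\right)\log\log n$: each $G'[S'_{i,j}]$ $\frac{a_2}{f(S_{i,j})\log n}$-respects the all-to-all problem on $X_{B_{S_{i,j}}}$; and there is a flow in $G'[S_i']$ with congestion $d\log n$ in which each split node of an edge between different $S_{i,j}$ (fixed $i$) sends one unit to $X_{B_{S_i}}$, and each node of $X_{B_{S_i}}$ receives at most $b$ units. **Theorem.** For all $a_1,a_2,b,d>0$ there are constants $\alpha'\ge1$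 and $C>0$, depending only on them, such that the following holds for all $G$, $c_f\ge 1$, $T$, $P$ as above. Let $S\in T$, let $S_1,\dots,S_t$ be merge-phase sub-clusters of $S$ computed with $\tau=1$, and for each $i$ let $S_{i,1},\dots,S_{i,t_i}$ be refinement-phase sub-clusters of $S_i$ computed with $\sigma=|S|$, where $L,R$ (when non-empty), all $S_i$ and all $S_{i,j}$ are clusters of $T$. Let $\alpha\ge1$, let $P_{S'_{i,j}}$ be demand states satisfying the invariant for $S_{i,j}$ with load $\alpha$, and let $P^{\mathrm{before}}=\sum_{i,j}P_{S'_{i,j}}$. Then there is a demand state $P^{\mathrm{after}}$ satisfying the invariant for $S$ with load $\alpha'$ such that for every $B\subseteq V$, with $B'=B\cup\{x_e:e\cap B\ne\emptyset\}$ and $W'=V'\setminus B'$, there are charges $\mathrm{charge}(e)\ge0$ satisfying $$\sum_{e\in E(B',W')\cap G'[S']}\mathrm{charge}(e)\ \ge\ \mathrm{dem}_{P^{\mathrm{before}}-P^{\mathrm{after}}}(B',W')$$ and $\mathrm{charge}(e)\le C\cdot\alpha\cdot\log n\cdot f(S_{i,j})$ for all $i,j$ and every $e\in E(B',W')\cap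 G'[S'_{i,j}]$. -/

import Mathlib

open scoped Classical

namespace TreeCut

/-! ### Cuts, demand matrices, flows -/

/-- The induced subgraph `H[A]`, kept on the vertex type `U` (vertices outside `A` are
isolated and carry neither demand nor flow). -/
def inducedOn {U : Type*} (H : SimpleGraph U) (A : Finset U) : SimpleGraph U :=
  (H.induce (A : Set U)).spanningCoe

theorem inducedOn_adj {U : Type*} (H : SimpleGraph U) (A : Finset U) (a b : U) :
    (inducedOn H A).Adj a b ↔ H.Adj a b ∧ a ∈ A ∧ b ∈ A := by
  simp [inducedOn]

section General

variable {U : Type*} [Fintype U]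

/-- The edges of `H` with exactly one endpoint in `A`, i.e. `E_H(A, U \ A)`. -/
noncomputable def cutEdges (H : SimpleGraph U) (A : Finset U) : Finset (Sym2 U) :=
  H.edgeFinset.filter (fun e => ∃ a ∈ A, ∃ b ∉ A, e = s(a, b))

/-- The capacity `cap_H(A, U \ A)` in an unweighted graph. -/
noncomputable def cutCap (H : SimpleGraph U) (A : Finset U) : ℝ :=
  ((cutEdges H A).card : ℝ)

/-- The demand of the demand matrix `Q` across the cut `(A, U \ A)`. -/
noncomputable def matrixDem (Q : U → U → ℝ) (A : Finset U) : ℝ :=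
  ∑ u ∈ A, ∑ v ∈ Aᶜ, (Q u v + Q v u)

/-- `H` `γ`-respects the demand matrix `Q`. -/
def RespectsMatrix (H : SimpleGraph U) (γ : ℝ) (Q : U → U → ℝ) : Prop :=
  ∀ A : Finset U, 0 < matrixDem Q A → γ ≤ cutCap H A / matrixDem Q A

/-- The all-to-all flow problem on `X`. -/
noncomputable def allToAll (X : Finset U) : U → U → ℝ :=
  fun u v => if u ∈ X ∧ v ∈ X then 1 / (X.card : ℝ) else 0

/-- The vertex set `X` `γ`-expands in `H`. -/
def Expands (H : SimpleGraph U) (γ : ℝ) (X : Finset U) : Prop :=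
  ∀ A : Finset U, 0 < min ((X ∩ A).card : ℝ) ((X \ A).card : ℝ) →
    γ ≤ cutCap H A / min ((X ∩ A).card : ℝ) ((X \ A).card : ℝ)

/-- The multi-commodity flow problem `Q` can be routed in `H` (unit capacities) with
congestion `c`. `f k a b` is the flow of the commodity with source `k` along the edge `ab` in
the direction from `a` to `b`; every `w ≠ k` absorbs exactly `Q k w` units of it. -/
def RoutableWith (H : SimpleGraph U) (Q : U → U → ℝ) (c : ℝ) : Prop :=
  ∃ f : U → U → U → ℝ,
    (∀ k a b, 0 ≤ f k a b) ∧
    (∀ k a b, f k a b ≠ 0 → H.Adj a b) ∧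
    (∀ k w, w ≠ k → ∑ a, f k a w - ∑ b, f k w b = Q k w) ∧
    (∀ a b, H.Adj a b → ∑ k, (f k a b + f k b a) ≤ c)

/-- There is a flow in `H` from `X` to `Z`, routable with congestion `c`, in which every
`x ∈ X` sends out exactly `send x` units and every `z ∈ Z` receives at most `recv` units. -/
def ExistsFlow (H : SimpleGraph U) (X Z : Finset U) (send : U → ℝ) (recv c : ℝ) : Prop :=
  ∃ Q : U → U → ℝ,
    (∀ u v, 0 ≤ Q u v) ∧
    (∀ u v, Q u v ≠ 0 → u ∈ X ∧ v ∈ Z) ∧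
    (∀ u ∈ X, ∑ v, Q u v = send u) ∧
    (∀ v ∈ Z, ∑ u, Q u v ≤ recv) ∧
    RoutableWith H Q c

/-! ### Demand states -/

variable {K : Type*} [Fintype K]

/-- `P` is a valid demand state. -/
def ValidState (P : U → K → ℝ) : Prop := ∀ k, ∑ u, P u k = 0

/-- The demand of the demand state `P` across the cut `(A, U \ A)`. -/
noncomputable def stateDem (P : U → K → ℝ) (A : Finset U) : ℝ :=
  ∑ k, |∑ u ∈ A, P u k|

end General

/-! ### Subdivision graph and clusters -/

section Subdivision

variable {V : Type*} [Fintype V]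

/-- Vertices of the subdivision graph: the vertices of `G` and a split vertex per edge. -/
abbrev SubV (G : SimpleGraph V) : Type _ := V ⊕ G.edgeSet

/-- The subdivision graph `G'`. -/
def subdivision (G : SimpleGraph V) : SimpleGraph (SubV G) :=
  SimpleGraph.fromRel (fun x y => ∃ (v : V) (e : G.edgeSet),
    x = Sum.inl v ∧ y = Sum.inr e ∧ v ∈ e.1)

/-- The split vertices `X_F` of a set `F` of edges. -/
noncomputable def splitNodes (G : SimpleGraph V) (F : Finset (Sym2 V)) : Finset (SubV G) :=
  Finset.univ.filter (fun x => ∃ e : G.edgeSet, x = Sum.inr e ∧ e.1 ∈ F)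

/-- `S' = S ∪ {x_e | e ∩ S ≠ ∅}`. -/
noncomputable def primed (G : SimpleGraph V) (S : Finset V) : Finset (SubV G) :=
  Finset.univ.filter (fun x =>
    (∃ v ∈ S, x = Sum.inl v) ∨ ∃ e : G.edgeSet, x = Sum.inr e ∧ ∃ v ∈ S, v ∈ e.1)

/-- The graph `G'[S']`. -/
noncomputable def clusterGraph (G : SimpleGraph V) (S : Finset V) : SimpleGraph (SubV G) :=
  inducedOn (subdivision G) (primed G S)

/-- The graph `G[S]'`, the subdivision graph of the induced subgraph `G[S]`. -/
noncomputable def innerClusterGraph (G : SimpleGraph V) (S : Finset V) :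
    SimpleGraph (SubV G) :=
  inducedOn (subdivision G) (Finset.univ.filter (fun x =>
    (∃ v ∈ S, x = Sum.inl v) ∨ ∃ e : G.edgeSet, x = Sum.inr e ∧ ∀ v ∈ e.1, v ∈ S))

/-- The split vertices `X_B` of the boundary edges `B = E(S, V \ S)` of `S`. -/
noncomputable def boundaryNodes (G : SimpleGraph V) (S : Finset V) : Finset (SubV G) :=
  splitNodes G (cutEdges G S)

/-- The edges of `G` between different parts of a partition. -/
noncomputable def interEdges (G : SimpleGraph V) (parts : Finset (Finset V)) :
    Finset (Sym2 V) :=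
  G.edgeFinset.filter (fun e =>
    ∃ C ∈ parts, ∃ D ∈ parts, C ≠ D ∧ ∃ u ∈ C, ∃ v ∈ D, e = s(u, v))

/-! ### The merge phase -/

/-- The side `R` of the second merge-phase cut: the vertices of `S` that can reach a node of
`X_B \ X_Y` in `G'[S'] \ X_Y`. -/
noncomputable def mergeR (G : SimpleGraph V) (S : Finset V) (Y : Finset (Sym2 V)) : Finset V :=
  S.filter (fun v => ∃ x ∈ boundaryNodes G S \ splitNodes G Y,
    (inducedOn (subdivision G) (primed G S \ splitNodes G Y)).Reachable (Sum.inl v) x)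

/-- The core `L = S \ R`. -/
noncomputable def mergeL (G : SimpleGraph V) (S : Finset V) (Y : Finset (Sym2 V)) : Finset V :=
  S \ mergeR G S Y

/-- The merge-phase sub-clusters: the non-empty sets among `L ∩ Z_i` and `R ∩ Z_i`. -/
noncomputable def mergeParts (G : SimpleGraph V) (S : Finset V) (Z : Finpartition S)
    (Y : Finset (Sym2 V)) : Finset (Finset V) :=
  (Z.parts.image (fun C => mergeL G S Y ∩ C) ∪
    Z.parts.image (fun C => mergeR G S Y ∩ C)).erase ∅

/-- The weighting `μ_τ` on split vertices: `τ` on boundary split vertices of `S`, otherwise 1. -/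
noncomputable def muTau (G : SimpleGraph V) (S : Finset V) (τ : ℝ) (x : SubV G) : ℝ :=
  if x ∈ boundaryNodes G S then τ else 1

/-- `(Z, Y)` is an output of the merge phase on `S` with parameter `τ`: `Z` is the first
partition and `Y` is the set of edges inducing the second partition `S = L ∪ R`. The number
`a` is the constant hidden in the expansion guarantee `Ω(1 / log n)`. -/
structure IsMergePhase (G : SimpleGraph V) (S : Finset V) (τ a : ℝ) (Z : Finpartition S)
    (Y : Finset (Sym2 V)) : Prop where
  connected : ∀ C ∈ Z.parts, (G.induce (C : Set V)).Connected
  card_le : ∀ C ∈ Z.parts, (C.card : ℝ) ≤ 2 / 3 * (S.card : ℝ)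
  expands : Expands (innerClusterGraph G S) (a / Real.logb 2 (Fintype.card V))
    (splitNodes G (interEdges G Z.parts))
  edges : ∀ e ∈ Y, e ∈ G.edgeSet ∧ ∃ v ∈ S, v ∈ e
  flow_to_boundary : ExistsFlow (clusterGraph G S) (splitNodes G Y) (boundaryNodes G S)
    (muTau G S τ) (2 * τ) 2
  flow_to_inter : ExistsFlow (clusterGraph G S) (splitNodes G Y)
    (splitNodes G (interEdges G Z.parts)) (muTau G S τ) 2 2
  separates : ∀ x ∈ splitNodes G (interEdges G Z.parts), ∀ b ∈ boundaryNodes G S,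
    ∀ p : (clusterGraph G S).Walk x b, ∃ y ∈ splitNodes G Y, y ∈ p.support

/-! ### The refinement phase -/

/-- `f(D) = c_f · log(σ / |D|) · log log n`. -/
noncomputable def fRef (V : Type*) [Fintype V] (cf σ : ℝ) (D : Finset V) : ℝ :=
  cf * Real.logb 2 (σ / (D.card : ℝ)) * Real.logb 2 (Real.logb 2 (Fintype.card V))

/-- `W` is an output of the refinement phase on `S` with parameter `σ`. The numbers `a`, `b`,
`d` are the constants hidden in the guarantees `Ω(1 / (f(D) log n))` for respecting the
all-to-all problem, `O(1)` for the received flow, and `O(log n)` for the congestion. -/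
structure IsRefinementPhase (G : SimpleGraph V) (S : Finset V) (cf σ a b d : ℝ)
    (W : Finpartition S) : Prop where
  respects : ∀ D ∈ W.parts, RespectsMatrix (clusterGraph G D)
    (a / (fRef V cf σ D * Real.logb 2 (Fintype.card V))) (allToAll (boundaryNodes G D))
  flow : ExistsFlow (clusterGraph G S) (splitNodes G (interEdges G W.parts))
    (boundaryNodes G S) (fun _ => 1) b (d * Real.logb 2 (Fintype.card V))

/-! ### The decomposition tree -/

/-- A hierarchical decomposition of `V`: a laminar family of non-empty clusters with root `V`
and leaves the singletons. -/
structure IsHierarchy (T : Finset (Finset V)) : Prop where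
  root : Finset.univ ∈ T
  leaf : ∀ v, {v} ∈ T
  nonempty : ∀ C ∈ T, C.Nonempty
  laminar : ∀ C ∈ T, ∀ D ∈ T, C ⊆ D ∨ D ⊆ C ∨ Disjoint C D

/-- The edges of the tree of the decomposition: pairs (cluster, parent cluster), where the
parent is the smallest cluster strictly containing the given one. -/
noncomputable def treeEdges (T : Finset (Finset V)) : Finset (Finset V × Finset V) :=
  (T ×ˢ T).filter (fun p => p.1 ⊂ p.2 ∧ ∀ D ∈ T, p.1 ⊂ D → p.2 ⊆ D)

/-- The capacity in the tree of the cut `(A, T \ A)`, where the tree edge from a cluster `C` to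
its parent has capacity `cap_G(C, V \ C)`. -/
noncomputable def treeCap (G : SimpleGraph V) (T A : Finset (Finset V)) : ℝ :=
  ∑ p ∈ (treeEdges T).filter (fun p => ¬ (p.1 ∈ A ↔ p.2 ∈ A)), cutCap G p.1

variable {K : Type*} [Fintype K]

/-- The tree of `T` `γ`-respects the demand state `P` on `V`; the demand of `v` resides at the
leaf `{v}`. -/
def TreeRespects (G : SimpleGraph V) (T : Finset (Finset V)) (γ : ℝ) (P : V → K → ℝ) : Prop :=
  ∀ A ⊆ T, 0 < stateDem P (Finset.univ.filter (fun v => {v} ∈ A)) →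
    γ ≤ treeCap G T A / stateDem P (Finset.univ.filter (fun v => {v} ∈ A))

/-! ### The invariant -/

/-- The demand state `PS` on `G'` satisfies the invariant for `S` with load `α`, relative to
the demand state `P` on `V`. -/
structure Invariant (G : SimpleGraph V) (P : V → K → ℝ) (S : Finset V) (α : ℝ)
    (PS : SubV G → K → ℝ) : Prop where
  supported : ∀ k, ∀ x, x ∉ boundaryNodes G S → PS x k = 0
  total : ∀ k, ∑ x ∈ primed G S, PS x k = ∑ v ∈ S, P v k
  load : ∀ x ∈ primed G S, ∑ k, |PS x k| ≤ α

end Subdivision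

end TreeCut

open TreeCut

set_option linter.unusedSectionVars false

namespace TreeCut

/-! ### Cuts and multi-commodity flows. -/

section Flows

variable {U : Type*} [Fintype U] {K : Type*} [Fintype K]

/-! Demand is moved from the boundaries of the sub-clusters to the boundary of `S`. A move along a
flow changes the demand across any cut by at most load times congestion times the capacity of the
cut in the graph carrying the flow (`ExistsFlow.exists_state`). The other moves use the all-to-all
guarantee (`RespectsMatrix.stateDem_sub_spread_le`) or expansion (`Expands.stateDem_le`). Costs add
by the triangle inequality, and the cluster graphs of disjoint clusters share no edge, so the costs
become charges per edge.

Refinement phase (`IsRefinementPhase.exists_state`): the demand of each `S_{i,j}` is spread evenly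
over its boundary, the only move whose cost involves `α` and `f`. The load per cluster then falls to
1: the tree respects `P`, so the total demand of a cluster of `T` is at most its number of boundary
edges (`TreeRespects.sum_abs_le`). The refinement flow carries the result to the boundaries of the
`S_i` with a load `c` independent of `α`.

Merge phase (`IsMergePhase.exists_state`): demand on `X_Y` or on the boundary of `S` can follow the
flow from `X_Y`. By separation, the rest, on `X_F \ X_Y`, belongs to sub-clusters inside `L`. Since
the boundary of `L` lies in `X_Y` and `L` is a cluster of `T`, the total of this rest is `O(|X_Y|)`,
so it fits on `X_Y` with constant load. To get it there, the flow from `X_Y` to `X_F` is used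
backwards, and expansion of `X_F` repairs the mismatch.

Costs without a factor `f` are absorbed because `f` is bounded below once `n ≥ 3` (`le_fRef`). For
`n = 2`, `f` vanishes, but so does the demand. -/

theorem mem_cutEdges {H : SimpleGraph U} {A : Finset U} {e : Sym2 U} :
    e ∈ cutEdges H A ↔ ∃ a b, e = s(a, b) ∧ H.Adj a b ∧ a ∈ A ∧ b ∉ A := by
  simp only [cutEdges, Finset.mem_filter, SimpleGraph.mem_edgeFinset]
  constructor
  · rintro ⟨he, a, ha, b, hb, rfl⟩
    exact ⟨a, b, rfl, he, ha, hb⟩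
  · rintro ⟨a, b, rfl, h, ha, hb⟩
    exact ⟨h, a, ha, b, hb, rfl⟩

theorem cutEdges_mono {H H' : SimpleGraph U} (h : H ≤ H') (A : Finset U) :
    cutEdges H A ⊆ cutEdges H' A := by
  intro e he
  obtain ⟨a, b, rfl, hab, ha, hb⟩ := mem_cutEdges.1 he
  exact mem_cutEdges.2 ⟨a, b, rfl, h hab, ha, hb⟩

theorem cutCap_mono {H H' : SimpleGraph U} (h : H ≤ H') (A : Finset U) :
    cutCap H A ≤ cutCap H' A := by
  unfold cutCap
  exact_mod_cast Finset.card_le_card (cutEdges_mono h A)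

theorem cutCap_nonneg (H : SimpleGraph U) (A : Finset U) : 0 ≤ cutCap H A :=
  Nat.cast_nonneg _

theorem cutCap_eq_card_pairs (H : SimpleGraph U) (A : Finset U) :
    cutCap H A = (((A ×ˢ Aᶜ).filter (fun p => H.Adj p.1 p.2)).card : ℝ) := by
  have : cutEdges H A
      = ((A ×ˢ Aᶜ).filter (fun p => H.Adj p.1 p.2)).image (fun p => s(p.1, p.2)) := by
    ext e
    simp only [mem_cutEdges, Finset.mem_image, Finset.mem_filter, Finset.mem_product,
      Finset.mem_compl, Prod.exists]
    constructor
    · rintro ⟨a, b, rfl, h, ha, hb⟩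
      exact ⟨a, b, ⟨⟨ha, hb⟩, h⟩, rfl⟩
    · rintro ⟨a, b, ⟨⟨ha, hb⟩, h⟩, rfl⟩
      exact ⟨a, b, rfl, h, ha, hb⟩
  unfold cutCap
  rw [this, Finset.card_image_of_injOn]
  rintro ⟨a, b⟩ h ⟨a', b'⟩ h' heq
  simp only [Finset.coe_filter, Finset.mem_product, Finset.mem_compl, Set.mem_ofPred_eq] at h h'
  simp only [Sym2.eq_iff] at heq
  rcases heq with ⟨rfl, rfl⟩ | ⟨rfl, rfl⟩
  · rfl
  · exact absurd h.1.1 h'.1.2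

/-- The net flow into `B` is at most the flow over the boundary of `B`. -/
theorem sum_netFlow_le (g : U → U → ℝ) (hg : ∀ a b, 0 ≤ g a b) (B : Finset U) :
    ∑ w ∈ B, (∑ a, g a w - ∑ b, g w b) ≤ ∑ w ∈ B, ∑ a ∈ Bᶜ, g a w := by
  have h1 : ∀ w, ∑ a, g a w = ∑ a ∈ B, g a w + ∑ a ∈ Bᶜ, g a w :=
    fun w => (Finset.sum_add_sum_compl B _).symm
  have h2 : ∀ w, ∑ a, g w a = ∑ a ∈ B, g w a + ∑ a ∈ Bᶜ, g w a :=
    fun w => (Finset.sum_add_sum_compl B _).symm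
  simp only [h1, h2, Finset.sum_sub_distrib, Finset.sum_add_distrib]
  have h3 : ∑ w ∈ B, ∑ a ∈ B, g a w = ∑ w ∈ B, ∑ a ∈ B, g w a := Finset.sum_comm
  have h4 : 0 ≤ ∑ w ∈ B, ∑ a ∈ Bᶜ, g w a :=
    Finset.sum_nonneg fun _ _ => Finset.sum_nonneg fun _ _ => hg _ _
  linarith

/-- A routable flow problem satisfies the cut condition. -/
theorem RoutableWith.matrixDem_le {H : SimpleGraph U} {Q : U → U → ℝ} {c : ℝ}
    (h : RoutableWith H Q c) (A : Finset U) : matrixDem Q A ≤ c * cutCap H A := by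
  obtain ⟨f, hf0, hfH, hfQ, hfc⟩ := h
  -- `RoutableWith` prescribes no balance at the source `k`, so net flow is summed over the side of
  -- the cut not containing `k`.
  have hout : ∀ k ∈ A, ∑ v ∈ Aᶜ, Q k v ≤ ∑ u ∈ A, ∑ v ∈ Aᶜ, f k u v := by
    intro k hk
    have h1 := sum_netFlow_le (f k) (hf0 k) Aᶜ
    rw [compl_compl, Finset.sum_comm (s := Aᶜ) (t := A)] at h1
    refine le_trans (le_of_eq (Finset.sum_congr rfl fun w hw => ?_)) h1
    exact (hfQ k w (by rintro rfl; exact (Finset.mem_compl.1 hw) hk)).symm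
  have hin : ∀ k ∈ Aᶜ, ∑ u ∈ A, Q k u ≤ ∑ u ∈ A, ∑ v ∈ Aᶜ, f k v u := by
    intro k hk
    have h1 := sum_netFlow_le (f k) (hf0 k) A
    refine le_trans (le_of_eq (Finset.sum_congr rfl fun w hw => ?_)) h1
    exact (hfQ k w (by rintro rfl; exact (Finset.mem_compl.1 hk) hw)).symm
  have h1 : matrixDem Q A ≤ ∑ k, ∑ u ∈ A, ∑ v ∈ Aᶜ, (f k u v + f k v u) := by
    unfold matrixDem
    rw [← Finset.sum_add_sum_compl A]
    simp only [Finset.sum_add_distrib]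
    rw [Finset.sum_comm (s := A) (t := Aᶜ) (f := fun u v => Q v u)]
    have e1 := Finset.sum_le_sum hout
    have e2 := Finset.sum_le_sum hin
    have e3 : 0 ≤ ∑ k ∈ A, ∑ u ∈ A, ∑ v ∈ Aᶜ, f k v u := Finset.sum_nonneg fun _ _ =>
      Finset.sum_nonneg fun _ _ => Finset.sum_nonneg fun _ _ => hf0 _ _ _
    have e4 : 0 ≤ ∑ k ∈ Aᶜ, ∑ u ∈ A, ∑ v ∈ Aᶜ, f k u v := Finset.sum_nonneg fun _ _ =>
      Finset.sum_nonneg fun _ _ => Finset.sum_nonneg fun _ _ => hf0 _ _ _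
    linarith
  have h2 : ∑ k, ∑ u ∈ A, ∑ v ∈ Aᶜ, (f k u v + f k v u)
      = ∑ p ∈ A ×ˢ Aᶜ, ∑ k, (f k p.1 p.2 + f k p.2 p.1) := by
    rw [Finset.sum_product, Finset.sum_comm]
    exact Finset.sum_congr rfl fun u _ => Finset.sum_comm
  have h3 : ∑ p ∈ A ×ˢ Aᶜ, ∑ k, (f k p.1 p.2 + f k p.2 p.1)
      ≤ ∑ p ∈ A ×ˢ Aᶜ, if H.Adj p.1 p.2 then c else 0 := by
    refine Finset.sum_le_sum fun p _ => ?_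
    split_ifs with hp
    · exact hfc _ _ hp
    · refine le_of_eq (Finset.sum_eq_zero fun k _ => ?_)
      have e1 : f k p.1 p.2 = 0 := by
        by_contra h
        exact hp (hfH _ _ _ h)
      have e2 : f k p.2 p.1 = 0 := by
        by_contra h
        exact hp (hfH _ _ _ h).symm
      rw [e1, e2, add_zero]
  rw [← Finset.sum_filter, Finset.sum_const, nsmul_eq_mul] at h3
  rw [cutCap_eq_card_pairs]
  linarith

theorem RespectsMatrix.matrixDem_le {H : SimpleGraph U} {γ : ℝ} {Q : U → U → ℝ}
    (h : RespectsMatrix H γ Q) (hγ : 0 < γ) (A : Finset U) :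
    matrixDem Q A ≤ γ⁻¹ * cutCap H A := by
  have hc := cutCap_nonneg H A
  rcases le_or_gt (matrixDem Q A) 0 with h0 | h0
  · exact h0.trans (by positivity)
  · have h1 := h A h0
    rw [le_div_iff₀ h0] at h1
    rw [inv_mul_eq_div, le_div_iff₀ hγ]
    linarith

/-! ### Demand across a cut under transport of demand states. -/

theorem stateDem_add_le (P Q : U → K → ℝ) (A : Finset U) :
    stateDem (P + Q) A ≤ stateDem P A + stateDem Q A := by
  unfold stateDem
  rw [← Finset.sum_add_distrib]
  refine Finset.sum_le_sum fun k _ => ?_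
  simp only [Pi.add_apply, Finset.sum_add_distrib]
  exact abs_add_le _ _

theorem stateDem_sub_le_add (P Q R : U → K → ℝ) (A : Finset U) :
    stateDem (P - R) A ≤ stateDem (P - Q) A + stateDem (Q - R) A := by
  have := stateDem_add_le (P - Q) (Q - R) A
  rwa [sub_add_sub_cancel] at this

theorem stateDem_sub_comm (P Q : U → K → ℝ) (A : Finset U) :
    stateDem (P - Q) A = stateDem (Q - P) A := by
  unfold stateDem
  refine Finset.sum_congr rfl fun k _ => ?_
  simp only [Pi.sub_apply, Finset.sum_sub_distrib]
  exact abs_sub_comm _ _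

theorem stateDem_sum_le {ι : Type*} (s : Finset ι) (P : ι → U → K → ℝ) (A : Finset U) :
    stateDem (∑ i ∈ s, P i) A ≤ ∑ i ∈ s, stateDem (P i) A := by
  induction s using Finset.induction_on with
  | empty => simp [stateDem]
  | insert i s hi ih =>
    rw [Finset.sum_insert hi, Finset.sum_insert hi]
    exact (stateDem_add_le _ _ _).trans (by linarith)

/-- Moving the demand of every `u ∈ X` along the row `Q u` of a stochastic matrix `Q` crosses a
cut by at most the load times the demand of `Q`. -/
theorem stateDem_sub_transport_le {Q : U → U → ℝ} (hQ : ∀ u v, 0 ≤ Q u v) {X : Finset U}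
    (hX : ∀ u ∈ X, ∑ v, Q u v = 1) {D : U → K → ℝ} (hD : ∀ u ∉ X, ∀ k, D u k = 0) {l : ℝ}
    (hl : ∀ u, ∑ k, |D u k| ≤ l) (A : Finset U) :
    stateDem (D - fun v k => ∑ u, Q u v * D u k) A ≤ l * matrixDem Q A := by
  -- Transfers inside `A` cancel; what leaves `A` minus what enters it remains.
  have key : ∀ k, ∑ x ∈ A, (D x k - ∑ u, Q u x * D u k)
      = ∑ u ∈ A, ∑ v ∈ Aᶜ, (Q u v * D u k - Q v u * D v k) := by
    intro k
    have h1 : ∀ x, D x k = ∑ v ∈ A, Q x v * D x k + ∑ v ∈ Aᶜ, Q x v * D x k := by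
      intro x
      rw [Finset.sum_add_sum_compl, ← Finset.sum_mul]
      by_cases hx : x ∈ X
      · rw [hX x hx, one_mul]
      · rw [hD x hx, mul_zero]
    have h2 : ∀ x, ∑ u, Q u x * D u k
        = ∑ v ∈ A, Q v x * D v k + ∑ v ∈ Aᶜ, Q v x * D v k :=
      fun x => (Finset.sum_add_sum_compl A _).symm
    rw [Finset.sum_sub_distrib, Finset.sum_congr rfl fun x _ => h1 x,
      Finset.sum_congr rfl fun x _ => h2 x]
    simp only [Finset.sum_add_distrib, Finset.sum_sub_distrib]
    rw [Finset.sum_comm (s := A) (t := A)]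
    ring
  unfold stateDem matrixDem
  simp only [Pi.sub_apply, key]
  calc ∑ k, |∑ u ∈ A, ∑ v ∈ Aᶜ, (Q u v * D u k - Q v u * D v k)|
      ≤ ∑ k, ∑ u ∈ A, ∑ v ∈ Aᶜ, (Q u v * |D u k| + Q v u * |D v k|) := by
        refine Finset.sum_le_sum fun k _ => (Finset.abs_sum_le_sum_abs _ _).trans
          (Finset.sum_le_sum fun u _ => (Finset.abs_sum_le_sum_abs _ _).trans
          (Finset.sum_le_sum fun v _ => ?_))
        have := abs_sub (Q u v * D u k) (Q v u * D v k)
        rwa [abs_mul, abs_mul, abs_of_nonneg (hQ _ _), abs_of_nonneg (hQ _ _)] at this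
    _ = ∑ u ∈ A, ∑ v ∈ Aᶜ, (Q u v * ∑ k, |D u k| + Q v u * ∑ k, |D v k|) := by
        rw [Finset.sum_comm]
        refine Finset.sum_congr rfl fun u _ => ?_
        rw [Finset.sum_comm]
        refine Finset.sum_congr rfl fun v _ => ?_
        rw [Finset.sum_add_distrib, Finset.mul_sum, Finset.mul_sum]
    _ ≤ l * ∑ u ∈ A, ∑ v ∈ Aᶜ, (Q u v + Q v u) := by
        rw [Finset.mul_sum]
        refine Finset.sum_le_sum fun u _ => ?_
        rw [Finset.mul_sum]
        refine Finset.sum_le_sum fun v _ => ?_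
        have e1 := mul_le_mul_of_nonneg_left (hl u) (hQ u v)
        have e2 := mul_le_mul_of_nonneg_left (hl v) (hQ v u)
        linarith

theorem sum_abs_transport_le {Q : U → U → ℝ} (hQ : ∀ u v, 0 ≤ Q u v) {D : U → K → ℝ} {l : ℝ}
    (hl : ∀ u, ∑ k, |D u k| ≤ l) (v : U) :
    ∑ k, |∑ u, Q u v * D u k| ≤ l * ∑ u, Q u v := by
  calc ∑ k, |∑ u, Q u v * D u k| ≤ ∑ k, ∑ u, Q u v * |D u k| := by
        refine Finset.sum_le_sum fun k _ => (Finset.abs_sum_le_sum_abs _ _).trans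
          (Finset.sum_le_sum fun u _ => ?_)
        rw [abs_mul, abs_of_nonneg (hQ _ _)]
    _ = ∑ u, Q u v * ∑ k, |D u k| := by
        rw [Finset.sum_comm]
        exact Finset.sum_congr rfl fun u _ => (Finset.mul_sum _ _ _).symm
    _ ≤ l * ∑ u, Q u v := by
        rw [Finset.mul_sum]
        refine Finset.sum_le_sum fun u _ => ?_
        have := mul_le_mul_of_nonneg_left (hl u) (hQ u v)
        linarith

theorem sum_abs_add_le (p q : K → ℝ) : ∑ k, |p k + q k| ≤ ∑ k, |p k| + ∑ k, |q k| := by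
  rw [← Finset.sum_add_distrib]
  exact Finset.sum_le_sum fun k _ => abs_add_le _ _

theorem sum_abs_sub_le (p q : K → ℝ) : ∑ k, |p k - q k| ≤ ∑ k, |p k| + ∑ k, |q k| := by
  rw [← Finset.sum_add_distrib]
  exact Finset.sum_le_sum fun k _ => abs_sub _ _

theorem sum_abs_sum_le {ι : Type*} (s : Finset ι) (p : ι → K → ℝ) :
    ∑ k, |∑ i ∈ s, p i k| ≤ ∑ i ∈ s, ∑ k, |p i k| := by
  rw [Finset.sum_comm]
  exact Finset.sum_le_sum fun k _ => Finset.abs_sum_le_sum_abs _ _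

/-- The part of a demand state that resides on `X`. -/
noncomputable def restrictState (D : U → K → ℝ) (X : Finset U) : U → K → ℝ :=
  fun x k => if x ∈ X then D x k else 0

theorem sum_abs_restrictState_le {D : U → K → ℝ} {l : ℝ} (hl : ∀ u, ∑ k, |D u k| ≤ l)
    (X : Finset U) (u : U) : ∑ k, |restrictState D X u k| ≤ l := by
  refine le_trans (Finset.sum_le_sum fun k _ => ?_) (hl u)
  unfold restrictState
  split_ifs <;> simp

theorem sum_abs_sub_restrictState_le {D : U → K → ℝ} {l : ℝ} (hl : ∀ u, ∑ k, |D u k| ≤ l)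
    (X : Finset U) (u : U) : ∑ k, |D u k - restrictState D X u k| ≤ l := by
  refine le_trans (Finset.sum_le_sum fun k _ => ?_) (hl u)
  unfold restrictState
  split_ifs <;> simp

/-- A flow from `X` to `Z` moves a demand state on `X ∪ Z` to `Z`. -/
theorem ExistsFlow.exists_state {H : SimpleGraph U} {X Z : Finset U} {send : U → ℝ}
    {r c : ℝ} (h : ExistsFlow H X Z send r c) (hsend : ∀ x, send x = 1) (hr : 0 ≤ r)
    {D : U → K → ℝ} {l : ℝ} (hD : ∀ x, x ∉ X → x ∉ Z → ∀ k, D x k = 0)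
    (hl0 : 0 ≤ l) (hl : ∀ x, ∑ k, |D x k| ≤ l) :
    ∃ D' : U → K → ℝ, (∀ x ∉ Z, ∀ k, D' x k = 0) ∧ (∀ x, ∑ k, |D' x k| ≤ l * (r + 1)) ∧
      (∀ k, ∑ x, D' x k = ∑ x, D x k) ∧
      ∀ A, stateDem (D - D') A ≤ l * c * cutCap H A := by
  obtain ⟨Q, hQ0, hQXZ, hQs, hQr, hQc⟩ := h
  have hrow : ∀ u ∈ X, ∑ v, Q u v = 1 := fun u hu => by rw [hQs u hu, hsend]
  set DX := restrictState D X with hDX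
  have hDX0 : ∀ u ∉ X, ∀ k, DX u k = 0 := fun u hu k => by simp [hDX, restrictState, hu]
  have hDXl : ∀ u, ∑ k, |DX u k| ≤ l := sum_abs_restrictState_le hl X
  set M : U → K → ℝ := fun v k => ∑ u, Q u v * DX u k with hM
  have hcol : ∀ v ∉ Z, ∀ u, Q u v = 0 := by
    intro v hv u
    by_contra h
    exact hv (hQXZ u v h).2
  have hMZ : ∀ v ∉ Z, ∀ k, M v k = 0 := by
    intro v hv k
    simp [hM, hcol v hv]
  have hMl : ∀ v, ∑ k, |M v k| ≤ l * r := by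
    intro v
    by_cases hv : v ∈ Z
    · exact (sum_abs_transport_le hQ0 hDXl v).trans
        (mul_le_mul_of_nonneg_left (hQr v hv) hl0)
    · simp only [hMZ v hv, abs_zero, Finset.sum_const_zero]
      positivity
  -- All demand on `X`, including that on `X ∩ Z`, follows the flow; `D - DX` is already on `Z` and
  -- stays put. It accounts for the `+ 1` in the load.
  refine ⟨M + (D - DX), ?_, ?_, ?_, ?_⟩
  · intro x hx k
    simp only [Pi.add_apply, Pi.sub_apply, hMZ x hx, zero_add]
    by_cases hxX : x ∈ X
    · simp [hDX, restrictState, hxX]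
    · rw [hDX0 x hxX, hD x hxX hx, sub_zero]
  · intro x
    have h1 := sum_abs_add_le (M x) ((D - DX) x)
    have h2 : ∑ k, |(D - DX) x k| ≤ l := sum_abs_sub_restrictState_le hl X x
    have h3 := hMl x
    simp only [Pi.add_apply] at h1 ⊢
    linarith
  · intro k
    have h1 : ∑ x, M x k = ∑ x, DX x k := by
      simp only [hM]
      rw [Finset.sum_comm]
      refine Finset.sum_congr rfl fun u _ => ?_
      rw [← Finset.sum_mul]
      by_cases hu : u ∈ X
      · rw [hrow u hu, one_mul]
      · rw [hDX0 u hu, mul_zero]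
    simp only [Pi.add_apply, Pi.sub_apply, Finset.sum_add_distrib, Finset.sum_sub_distrib, h1]
    ring
  · intro A
    have h1 : D - (M + (D - DX)) = DX - M := by abel
    rw [h1, mul_assoc]
    exact (stateDem_sub_transport_le hQ0 hrow hDX0 hDXl A).trans
      (mul_le_mul_of_nonneg_left (hQc.matrixDem_le A) hl0)

/-- The total of `D`, spread evenly over `X`. -/
noncomputable def spreadState (q : K → ℝ) (X : Finset U) : U → K → ℝ :=
  fun x k => if x ∈ X then q k / (X.card : ℝ) else 0

/-- Spreading over the empty set would lose demand, hence the hypothesis `hq`. -/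
theorem sum_spreadState {q : K → ℝ} {X : Finset U} (hq : X = ∅ → ∀ k, q k = 0) (k : K) :
    ∑ x, spreadState q X x k = q k := by
  unfold spreadState
  rw [← Finset.sum_filter, Finset.filter_mem_eq_inter, Finset.univ_inter, Finset.sum_const,
    nsmul_eq_mul]
  rcases X.eq_empty_or_nonempty with h | h
  · simp [h, hq h]
  · have : (X.card : ℝ) ≠ 0 := by exact_mod_cast h.card_pos.ne'
    field_simp

theorem sum_abs_spreadState_le {q : K → ℝ} {X : Finset U} {l : ℝ} (hl : 0 ≤ l)
    (hq : ∑ k, |q k| ≤ l * X.card) (x : U) : ∑ k, |spreadState q X x k| ≤ l := by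
  unfold spreadState
  by_cases hx : x ∈ X
  · simp only [hx, if_true, abs_div, Nat.abs_cast]
    rw [← Finset.sum_div]
    have : (0 : ℝ) < X.card := by exact_mod_cast Finset.card_pos.2 ⟨x, hx⟩
    rwa [div_le_iff₀ this]
  · simpa [hx] using hl

/-- If `H` respects the all-to-all problem on `X`, then a demand state on `X` can be spread. -/
theorem RespectsMatrix.stateDem_sub_spread_le {H : SimpleGraph U} {γ : ℝ} {X : Finset U}
    (h : RespectsMatrix H γ (allToAll X)) (hγ : 0 < γ) {D : U → K → ℝ} {l : ℝ} (hl0 : 0 ≤ l)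
    (hD : ∀ x ∉ X, ∀ k, D x k = 0) (hl : ∀ x, ∑ k, |D x k| ≤ l) (A : Finset U) :
    stateDem (D - spreadState (fun k => ∑ x, D x k) X) A ≤ l * γ⁻¹ * cutCap H A := by
  have h0 : ∀ u v, 0 ≤ allToAll X u v := by
    intro u v
    unfold allToAll
    split_ifs <;> positivity
  have h1 : ∀ u ∈ X, ∑ v, allToAll X u v = 1 := by
    intro u hu
    unfold allToAll
    simp only [hu, true_and]
    rw [← Finset.sum_filter, Finset.filter_mem_eq_inter, Finset.univ_inter, Finset.sum_const,
      nsmul_eq_mul]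
    have : (X.card : ℝ) ≠ 0 := by exact_mod_cast (Finset.card_pos.2 ⟨u, hu⟩).ne'
    field_simp
  -- Each row of `allToAll X` indexed by `X` is uniform on `X`, diagonal included, so transport
  -- along it is averaging.
  have h2 : (fun v k => ∑ u, allToAll X u v * D u k)
      = spreadState (fun k => ∑ x, D x k) X := by
    funext v k
    unfold spreadState allToAll
    by_cases hv : v ∈ X
    · simp only [hv, and_true, if_true]
      rw [Finset.sum_div]
      refine Finset.sum_congr rfl fun u _ => ?_
      by_cases hu : u ∈ X
      · simp only [hu, if_true]
        ring
      · simp [hu, hD u hu]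
    · simp [hv]
  rw [← h2, mul_assoc]
  exact (stateDem_sub_transport_le h0 h1 hD hl A).trans
    (mul_le_mul_of_nonneg_left (h.matrixDem_le hγ A) hl0)

/-- If `X` expands in `H`, then a valid demand state on `X` satisfies the cut condition. -/
theorem Expands.stateDem_le {H : SimpleGraph U} {γ : ℝ} {X : Finset U} (h : Expands H γ X)
    (hγ : 0 < γ) {D : U → K → ℝ} {l : ℝ} (hl0 : 0 ≤ l) (hD : ∀ x ∉ X, ∀ k, D x k = 0)
    (hl : ∀ x, ∑ k, |D x k| ≤ l) (hval : ValidState D) (A : Finset U) :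
    stateDem D A ≤ l * γ⁻¹ * cutCap H A := by
  have hsum : ∀ B : Finset U, ∀ k, ∑ u ∈ B, D u k = ∑ u ∈ B ∩ X, D u k := by
    intro B k
    refine (Finset.sum_subset Finset.inter_subset_left fun x hx hx' => hD x ?_ k).symm
    exact fun hxX => hx' (Finset.mem_inter.2 ⟨hx, hxX⟩)
  have hbd : ∀ B : Finset U, stateDem D B ≤ l * ((X ∩ B).card : ℝ) := by
    intro B
    unfold stateDem
    simp only [hsum B]
    refine (sum_abs_sum_le (B ∩ X) D).trans ?_
    refine (Finset.sum_le_sum fun u _ => hl u).trans ?_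
    rw [Finset.sum_const, nsmul_eq_mul, Finset.inter_comm, mul_comm]
  -- Validity makes the two sides carry opposite demand, so the cardinality bound may be taken on
  -- the smaller side.
  have hcompl : stateDem D A = stateDem D Aᶜ := by
    unfold stateDem
    refine Finset.sum_congr rfl fun k _ => ?_
    have h1 := hval k
    rw [← Finset.sum_add_sum_compl A] at h1
    rw [eq_neg_of_add_eq_zero_left h1, abs_neg]
  have hX : X ∩ Aᶜ = X \ A := by
    ext
    simp
  have h1 := hbd A
  have h2 := hbd Aᶜ
  rw [← hcompl, hX] at h2
  have h3 : stateDem D A ≤ l * min ((X ∩ A).card : ℝ) ((X \ A).card : ℝ) := by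
    rcases min_cases ((X ∩ A).card : ℝ) ((X \ A).card : ℝ) with h | h <;> rw [h.1] <;> assumption
  have hc := cutCap_nonneg H A
  rw [mul_assoc]
  refine h3.trans (mul_le_mul_of_nonneg_left ?_ hl0)
  rcases le_or_gt (min ((X ∩ A).card : ℝ) ((X \ A).card : ℝ)) 0 with h0 | h0
  · exact h0.trans (by positivity)
  · have h4 := h A h0
    rw [le_div_iff₀ h0] at h4
    rw [inv_mul_eq_div, le_div_iff₀ hγ]
    linarith

end Flows

end TreeCut

namespace TreeCut

/-! ### The subdivision graph, cluster graphs and their boundaries. -/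

section Structure

variable {V : Type*} [Fintype V] {K : Type*} [Fintype K] {G : SimpleGraph V}

theorem subdivision_adj {x y : SubV G} : (subdivision G).Adj x y ↔
    ∃ (v : V) (e : G.edgeSet), v ∈ e.1 ∧
      (x = Sum.inl v ∧ y = Sum.inr e ∨ y = Sum.inl v ∧ x = Sum.inr e) := by
  simp only [subdivision, SimpleGraph.fromRel_adj]
  constructor
  · rintro ⟨-, ⟨v, e, hx, hy, hv⟩ | ⟨v, e, hx, hy, hv⟩⟩
    · exact ⟨v, e, hv, Or.inl ⟨hx, hy⟩⟩
    · exact ⟨v, e, hv, Or.inr ⟨hx, hy⟩⟩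
  · rintro ⟨v, e, hv, ⟨rfl, rfl⟩ | ⟨rfl, rfl⟩⟩
    · exact ⟨by simp, Or.inl ⟨v, e, rfl, rfl, hv⟩⟩
    · exact ⟨by simp, Or.inr ⟨v, e, rfl, rfl, hv⟩⟩

theorem inl_mem_primed {S : Finset V} {v : V} : (Sum.inl v : SubV G) ∈ primed G S ↔ v ∈ S := by
  simp [primed]

theorem inr_mem_primed {S : Finset V} {e : G.edgeSet} :
    (Sum.inr e : SubV G) ∈ primed G S ↔ ∃ v ∈ S, v ∈ e.1 := by
  simp only [primed, Finset.mem_filter, Finset.mem_univ, true_and, reduceCtorEq, and_false,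
    exists_false, false_or, Sum.inr.injEq]
  constructor
  · rintro ⟨e', rfl, h⟩
    exact h
  · exact fun h => ⟨e, rfl, h⟩

theorem inr_mem_splitNodes {F : Finset (Sym2 V)} {e : G.edgeSet} :
    (Sum.inr e : SubV G) ∈ splitNodes G F ↔ e.1 ∈ F := by
  simp only [splitNodes, Finset.mem_filter, Finset.mem_univ, true_and, Sum.inr.injEq]
  constructor
  · rintro ⟨e', rfl, h⟩
    exact h
  · exact fun h => ⟨e, rfl, h⟩

theorem inl_notMem_splitNodes {F : Finset (Sym2 V)} {v : V} :
    (Sum.inl v : SubV G) ∉ splitNodes G F := by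
  simp [splitNodes]

theorem mem_boundaryNodes {S : Finset V} {x : SubV G} : x ∈ boundaryNodes G S ↔
    ∃ (u v : V) (h : G.Adj u v), x = Sum.inr ⟨s(u, v), h⟩ ∧ u ∈ S ∧ v ∉ S := by
  constructor
  · intro hx
    rcases x with v | e
    · exact absurd hx inl_notMem_splitNodes
    · obtain ⟨u, v, he, h, hu, hv⟩ := mem_cutEdges.1 (inr_mem_splitNodes.1 hx)
      exact ⟨u, v, h, by rw [Sum.inr.injEq]; exact Subtype.ext he, hu, hv⟩
  · rintro ⟨u, v, h, rfl, hu, hv⟩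
    exact inr_mem_splitNodes.2 (mem_cutEdges.2 ⟨u, v, rfl, h, hu, hv⟩)

theorem inr_mem_interEdges {parts : Finset (Finset V)} {u v : V} {h : G.Adj u v} {C D : Finset V}
    (hC : C ∈ parts) (hD : D ∈ parts) (hCD : C ≠ D) (hu : u ∈ C) (hv : v ∈ D) :
    (Sum.inr ⟨s(u, v), h⟩ : SubV G) ∈ splitNodes G (interEdges G parts) := by
  refine inr_mem_splitNodes.2 (Finset.mem_filter.2 ⟨SimpleGraph.mem_edgeFinset.2 h, ?_⟩)
  exact ⟨C, hC, D, hD, hCD, u, hu, v, hv, rfl⟩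

theorem boundaryNodes_subset_primed (S : Finset V) : boundaryNodes G S ⊆ primed G S := by
  intro x hx
  obtain ⟨u, v, h, rfl, hu, -⟩ := mem_boundaryNodes.1 hx
  exact inr_mem_primed.2 ⟨u, hu, Sym2.mem_mk_left u v⟩

theorem card_boundaryNodes (S : Finset V) : ((boundaryNodes G S).card : ℝ) = cutCap G S := by
  unfold cutCap
  rw [Nat.cast_inj]
  refine Finset.card_nbij' (s := boundaryNodes G S) (t := cutEdges G S)
    -- The values `s(v, v)` here and `Sum.inl` in the inverse are fillers, never used on the two
    -- sets.
    (i := fun x => Sum.elim (fun v => s(v, v)) (fun e => e.1) x)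
    (j := fun e => if h : e ∈ G.edgeSet then Sum.inr ⟨e, h⟩ else Sum.inl (Quot.out e).1)
    ?_ ?_ ?_ ?_
  · intro x hx
    obtain ⟨u, v, h, rfl, hu, hv⟩ := mem_boundaryNodes.1 hx
    exact mem_cutEdges.2 ⟨u, v, rfl, h, hu, hv⟩
  · intro e he
    obtain ⟨u, v, rfl, h, hu, hv⟩ := mem_cutEdges.1 he
    have h' : s(u, v) ∈ G.edgeSet := h
    simp only [h', dif_pos]
    exact mem_boundaryNodes.2 ⟨u, v, h, rfl, hu, hv⟩
  · intro x hx
    obtain ⟨u, v, h, rfl, hu, hv⟩ := mem_boundaryNodes.1 hx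
    have h' : s(u, v) ∈ G.edgeSet := h
    simp only [Sum.elim_inr]
    exact dif_pos h'
  · intro e he
    obtain ⟨u, v, rfl, h, hu, hv⟩ := mem_cutEdges.1 he
    have h' : s(u, v) ∈ G.edgeSet := h
    simp only [h', dif_pos, Sum.elim_inr]

theorem clusterGraph_adj {S : Finset V} {x y : SubV G} : (clusterGraph G S).Adj x y ↔
    ∃ (v : V) (e : G.edgeSet), v ∈ S ∧ v ∈ e.1 ∧
      (x = Sum.inl v ∧ y = Sum.inr e ∨ y = Sum.inl v ∧ x = Sum.inr e) := by
  rw [clusterGraph, inducedOn_adj, subdivision_adj]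
  constructor
  · rintro ⟨⟨v, e, hv, ⟨rfl, rfl⟩ | ⟨rfl, rfl⟩⟩, hx, hy⟩
    · exact ⟨v, e, inl_mem_primed.1 hx, hv, Or.inl ⟨rfl, rfl⟩⟩
    · exact ⟨v, e, inl_mem_primed.1 hy, hv, Or.inr ⟨rfl, rfl⟩⟩
  · rintro ⟨v, e, hS, hv, ⟨rfl, rfl⟩ | ⟨rfl, rfl⟩⟩
    · exact ⟨⟨v, e, hv, Or.inl ⟨rfl, rfl⟩⟩, inl_mem_primed.2 hS, inr_mem_primed.2 ⟨v, hS, hv⟩⟩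
    · exact ⟨⟨v, e, hv, Or.inr ⟨rfl, rfl⟩⟩, inr_mem_primed.2 ⟨v, hS, hv⟩, inl_mem_primed.2 hS⟩

theorem mem_edgeSet_clusterGraph {S : Finset V} {a : Sym2 (SubV G)} :
    a ∈ (clusterGraph G S).edgeSet ↔
      ∃ (v : V) (e : G.edgeSet), v ∈ S ∧ v ∈ e.1 ∧ a = s(Sum.inl v, Sum.inr e) := by
  induction a using Sym2.ind with
  | _ x y =>
    rw [SimpleGraph.mem_edgeSet, clusterGraph_adj]
    refine exists_congr fun v => exists_congr fun e => and_congr_right fun _ =>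
      and_congr_right fun _ => ?_
    rw [Sym2.eq_iff]
    tauto

theorem clusterGraph_mono {C S : Finset V} (h : C ⊆ S) : clusterGraph G C ≤ clusterGraph G S := by
  intro x y hxy
  obtain ⟨v, e, hv, hve, hxy⟩ := clusterGraph_adj.1 hxy
  exact clusterGraph_adj.2 ⟨v, e, h hv, hve, hxy⟩

theorem innerClusterGraph_le (S : Finset V) : innerClusterGraph G S ≤ clusterGraph G S := by
  intro x y hxy
  rw [innerClusterGraph, inducedOn_adj, subdivision_adj] at hxy
  obtain ⟨⟨v, e, hv, ⟨rfl, rfl⟩ | ⟨rfl, rfl⟩⟩, hx, hy⟩ := hxy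
  · exact clusterGraph_adj.2 ⟨v, e, by simpa using hx, hv, Or.inl ⟨rfl, rfl⟩⟩
  · exact clusterGraph_adj.2 ⟨v, e, by simpa using hy, hv, Or.inr ⟨rfl, rfl⟩⟩

theorem mem_edgeSet_of_mem_cutEdges {U : Type*} [Fintype U] {H : SimpleGraph U} {A : Finset U}
    {e : Sym2 U} (h : e ∈ cutEdges H A) : e ∈ H.edgeSet := by
  obtain ⟨a, b, rfl, hab, -⟩ := mem_cutEdges.1 h
  exact hab

/-- An edge of a cluster graph has a single end in `V`, and that end lies in the cluster. -/
theorem eq_of_mem_edgeSet_clusterGraph {𝒟 : Set (Finset V)} (h𝒟 : 𝒟.PairwiseDisjoint id)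
    {C D : Finset V} (hC : C ∈ 𝒟) (hD : D ∈ 𝒟) {a : Sym2 (SubV G)}
    (haC : a ∈ (clusterGraph G C).edgeSet) (haD : a ∈ (clusterGraph G D).edgeSet) : C = D := by
  obtain ⟨v, e, hv, -, rfl⟩ := mem_edgeSet_clusterGraph.1 haC
  obtain ⟨w, e', hw, -, h⟩ := mem_edgeSet_clusterGraph.1 haD
  simp only [Sym2.eq_iff, Sum.inl.injEq, reduceCtorEq, false_and, or_false] at h
  by_contra hCD
  exact Finset.disjoint_left.1 (h𝒟 hC hD hCD) hv (h.1 ▸ hw)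

/-- The edges of `G'[S']` are partitioned by the edges of the graphs `G'[C']`, where `C` ranges
over the parts of a partition of `S`. -/
theorem sum_cutEdges_clusterGraph {S : Finset V} (W : Finpartition S) (A : Finset (SubV G))
    (g : Sym2 (SubV G) → ℝ) : ∑ e ∈ cutEdges (clusterGraph G S) A, g e
      = ∑ C ∈ W.parts, ∑ e ∈ cutEdges (clusterGraph G C) A, g e := by
  rw [← Finset.sum_biUnion]
  · refine Finset.sum_congr ?_ fun _ _ => rfl
    ext a
    simp only [Finset.mem_biUnion]
    constructor
    · intro h
      obtain ⟨x, y, rfl, hxy, hx, hy⟩ := mem_cutEdges.1 h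
      obtain ⟨v, e, hv, hve, hxy⟩ := clusterGraph_adj.1 hxy
      obtain ⟨C, hC, hvC⟩ := W.exists_mem hv
      exact ⟨C, hC, mem_cutEdges.2
        ⟨x, y, rfl, clusterGraph_adj.2 ⟨v, e, hvC, hve, hxy⟩, hx, hy⟩⟩
    · rintro ⟨C, hC, h⟩
      exact cutEdges_mono (clusterGraph_mono (W.le hC)) A h
  · intro C hC D hD hCD
    refine Finset.disjoint_left.2 fun a haC haD => hCD ?_
    exact eq_of_mem_edgeSet_clusterGraph W.disjoint hC hD (mem_edgeSet_of_mem_cutEdges haC)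
      (mem_edgeSet_of_mem_cutEdges haD)

theorem cutCap_clusterGraph {S : Finset V} (W : Finpartition S) (A : Finset (SubV G)) :
    cutCap (clusterGraph G S) A = ∑ C ∈ W.parts, cutCap (clusterGraph G C) A := by
  have := sum_cutEdges_clusterGraph W A (fun _ => 1)
  simpa [cutCap] using this

/-- Edge-disjointness of the cluster graphs makes a charge depending only on the cluster well
defined. -/
theorem exists_charge {𝒟 : Set (Finset V)} (h𝒟 : 𝒟.PairwiseDisjoint id) (κ : Finset V → ℝ)
    (hκ : ∀ D ∈ 𝒟, 0 ≤ κ D) : ∃ charge : Sym2 (SubV G) → ℝ, (∀ e, 0 ≤ charge e) ∧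
      ∀ D ∈ 𝒟, ∀ e ∈ (clusterGraph G D).edgeSet, charge e = κ D := by
  refine ⟨fun e => if h : ∃ D ∈ 𝒟, e ∈ (clusterGraph G D).edgeSet then κ h.choose else 0,
    fun e => ?_, fun D hD e he => ?_⟩
  · dsimp only
    split_ifs with h
    · exact hκ _ h.choose_spec.1
    · exact le_rfl
  · have h : ∃ D ∈ 𝒟, e ∈ (clusterGraph G D).edgeSet := ⟨D, hD, he⟩
    dsimp only
    rw [dif_pos h, eq_of_mem_edgeSet_clusterGraph h𝒟 h.choose_spec.1 hD h.choose_spec.2 he]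

/-- A split vertex lies on the boundary of at most two of a family of disjoint clusters. -/
theorem sum_abs_sum_boundary_le {𝒟 : Finset (Finset V)}
    (h𝒟 : (𝒟 : Set (Finset V)).PairwiseDisjoint id) {D : Finset V → SubV G → K → ℝ} {l : ℝ}
    (hl0 : 0 ≤ l) (hD : ∀ C ∈ 𝒟, ∀ x ∉ boundaryNodes G C, ∀ k, D C x k = 0)
    (hl : ∀ C ∈ 𝒟, ∀ x, ∑ k, |D C x k| ≤ l) (x : SubV G) :
    ∑ k, |∑ C ∈ 𝒟, D C x k| ≤ 2 * l := by
  have hcard : (𝒟.filter (fun C => x ∈ boundaryNodes G C)).card ≤ 2 := by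
    rcases x with v | ⟨e, he⟩
    · have h : 𝒟.filter (fun C => (Sum.inl v : SubV G) ∈ boundaryNodes G C) = ∅ :=
        Finset.filter_eq_empty_iff.2 fun C _ => inl_notMem_splitNodes
      rw [h]
      simp
    · induction e using Sym2.ind with
      | _ u v =>
        have h1 : ∀ w : V, (𝒟.filter (fun C => w ∈ C)).card ≤ 1 := by
          refine fun w => Finset.card_le_one.2 fun C hC D hD => ?_
          rw [Finset.mem_filter] at hC hD
          by_contra hCD
          exact Finset.disjoint_left.1 (h𝒟 hC.1 hD.1 hCD) hC.2 hD.2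
        have h2 : 𝒟.filter (fun C => (Sum.inr ⟨s(u, v), he⟩ : SubV G) ∈ boundaryNodes G C)
            ⊆ 𝒟.filter (fun C => u ∈ C) ∪ 𝒟.filter (fun C => v ∈ C) := by
          intro C hC
          rw [Finset.mem_filter] at hC
          obtain ⟨w, hw, hwe⟩ := inr_mem_primed.1 (boundaryNodes_subset_primed C hC.2)
          rcases Sym2.mem_iff.1 hwe with rfl | rfl
          · exact Finset.mem_union_left _ (Finset.mem_filter.2 ⟨hC.1, hw⟩)
          · exact Finset.mem_union_right _ (Finset.mem_filter.2 ⟨hC.1, hw⟩)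
        have h3 := (Finset.card_le_card h2).trans (Finset.card_union_le _ _)
        have := h1 u
        have := h1 v
        omega
  have h1 : ∀ k, ∑ C ∈ 𝒟, D C x k
      = ∑ C ∈ 𝒟.filter (fun C => x ∈ boundaryNodes G C), D C x k := by
    intro k
    rw [Finset.sum_filter]
    refine Finset.sum_congr rfl fun C hC => ?_
    split_ifs with h
    · rfl
    · exact hD C hC x h k
  simp only [h1]
  refine (sum_abs_sum_le _ (fun C => D C x)).trans ?_
  refine (Finset.sum_le_sum fun C hC => hl C (Finset.mem_filter.1 hC).1 x).trans ?_
  rw [Finset.sum_const, nsmul_eq_mul]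
  exact mul_le_mul_of_nonneg_right (by exact_mod_cast hcard) hl0

/-! ### Consequences of the tree respecting `P`. -/

/-- Only the edge from `C` to its parent leaves the subtree below `C`; it is unique by minimality of
the parent and missing at the root. -/
theorem treeCap_subtree_le {T : Finset (Finset V)} {C : Finset V} (hCT : C ∈ T) :
    treeCap G T (T.filter (fun D => D ⊆ C)) ≤ cutCap G C := by
  unfold treeCap
  set E := (treeEdges T).filter
    (fun p => ¬ (p.1 ∈ T.filter (fun D => D ⊆ C) ↔ p.2 ∈ T.filter (fun D => D ⊆ C))) with hE
  have h1 : ∀ p ∈ E, p.1 = C ∧ p.2 ∈ T ∧ C ⊂ p.2 ∧ ∀ D ∈ T, C ⊂ D → p.2 ⊆ D := by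
    rintro ⟨A, B⟩ hp
    simp only [hE, treeEdges, Finset.mem_filter, Finset.mem_product] at hp
    obtain ⟨⟨⟨hA, hB⟩, hAB, hmin⟩, hiff⟩ := hp
    have h2 : ¬ (A ⊆ C ↔ B ⊆ C) := by
      intro h
      exact hiff ⟨fun h' => ⟨hB, h.1 h'.2⟩, fun h' => ⟨hA, h.2 h'.2⟩⟩
    have h3 : A ⊆ C := by
      by_contra h
      exact h2 ⟨fun h' => absurd h' h, fun h' => absurd (hAB.subset.trans h') h⟩
    have h4 : A = C := by
      by_contra h
      exact h2 ⟨fun _ => hmin C hCT (h3.ssubset_of_ne h), fun _ => h3⟩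
    subst h4
    exact ⟨rfl, hB, hAB, hmin⟩
  have h2 : E.card ≤ 1 := by
    refine Finset.card_le_one.2 fun p hp q hq => ?_
    obtain ⟨hp1, hp2, hp3, hp4⟩ := h1 p hp
    obtain ⟨hq1, hq2, hq3, hq4⟩ := h1 q hq
    exact Prod.ext (hp1.trans hq1.symm)
      (Finset.Subset.antisymm (hp4 _ hq2 hq3) (hq4 _ hp2 hp3))
  rw [Finset.sum_congr rfl fun p hp => by rw [(h1 p hp).1], Finset.sum_const, nsmul_eq_mul]
  have h3 : (E.card : ℝ) ≤ 1 := by exact_mod_cast h2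
  have := mul_le_mul_of_nonneg_right h3 (cutCap_nonneg G C)
  linarith

/-- Apply the cut condition to the subtree below `C`, whose leaves are the vertices of `C`. This is
the source of every load bound free of `α`. -/
theorem TreeRespects.sum_abs_le {T : Finset (Finset V)} {P : V → K → ℝ}
    (hP : TreeRespects G T 1 P) (hT : IsHierarchy T) {C : Finset V} (hC : C ∈ T) :
    ∑ k, |∑ v ∈ C, P v k| ≤ cutCap G C := by
  have hA : Finset.univ.filter (fun v => {v} ∈ T.filter (fun D => D ⊆ C)) = C := by
    ext v
    simp [hT.leaf v]
  have h := hP (T.filter (fun D => D ⊆ C)) (Finset.filter_subset _ _)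
  rw [hA] at h
  change stateDem P C ≤ _
  rcases le_or_gt (stateDem P C) 0 with h0 | h0
  · exact h0.trans (cutCap_nonneg G C)
  · have h1 := h h0
    rw [le_div_iff₀ h0, one_mul] at h1
    exact h1.trans (treeCap_subtree_le hC)

/-- A boundary split vertex of a part is a split vertex between parts or a boundary one. -/
theorem mem_boundaryNodes_part {S : Finset V} (W : Finpartition S) {C : Finset V}
    (hC : C ∈ W.parts) {x : SubV G} (hx : x ∈ boundaryNodes G C) :
    x ∈ splitNodes G (interEdges G W.parts) ∨ x ∈ boundaryNodes G S := by
  obtain ⟨u, v, h, rfl, hu, hv⟩ := mem_boundaryNodes.1 hx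
  by_cases hvS : v ∈ S
  · obtain ⟨D, hD, hvD⟩ := W.exists_mem hvS
    refine Or.inl (inr_mem_interEdges hC hD ?_ hu hvD)
    rintro rfl
    exact hv hvD
  · exact Or.inr (mem_boundaryNodes.2 ⟨u, v, h, rfl, W.le hC hu, hvS⟩)

theorem support_subset_inducedOn {U : Type*} {H : SimpleGraph U} {A : Finset U} {x y : U}
    (p : (inducedOn H A).Walk x y) (hx : x ∈ A) : ∀ z ∈ p.support, z ∈ A := by
  induction p with
  | nil =>
    intro z hz
    rw [SimpleGraph.Walk.support_nil, List.mem_singleton] at hz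
    exact hz ▸ hx
  | cons h p ih =>
    intro z hz
    rw [SimpleGraph.Walk.support_cons, List.mem_cons] at hz
    rcases hz with rfl | hz
    · exact hx
    · exact ih ((inducedOn_adj _ _ _ _).1 h).2.2 z hz

/-! ### The sets `L` and `R` and the boundaries of the merge-phase sub-clusters. -/

section Merge

variable {S : Finset V} {Y : Finset (Sym2 V)} {Z : Finpartition S}

theorem mergeR_subset : mergeR G S Y ⊆ S := Finset.filter_subset _ _

theorem mergeL_subset : mergeL G S Y ⊆ S := Finset.sdiff_subset

theorem mem_mergeL_or_mem_mergeR {v : V} (hv : v ∈ S) : v ∈ mergeL G S Y ∨ v ∈ mergeR G S Y := by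
  by_cases h : v ∈ mergeR G S Y
  · exact Or.inr h
  · exact Or.inl (Finset.mem_sdiff.2 ⟨hv, h⟩)

theorem disjoint_mergeL_mergeR : Disjoint (mergeL G S Y) (mergeR G S Y) :=
  Finset.sdiff_disjoint

theorem mem_mergeParts {C : Finset V} : C ∈ mergeParts G S Z Y ↔
    C ≠ ∅ ∧ ∃ D ∈ Z.parts, C = mergeL G S Y ∩ D ∨ C = mergeR G S Y ∩ D := by
  simp only [mergeParts, Finset.mem_erase, Finset.mem_union, Finset.mem_image]
  refine and_congr_right fun _ => ?_
  constructor
  · rintro (⟨D, hD, rfl⟩ | ⟨D, hD, rfl⟩)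
    · exact ⟨D, hD, Or.inl rfl⟩
    · exact ⟨D, hD, Or.inr rfl⟩
  · rintro ⟨D, hD, rfl | rfl⟩
    · exact Or.inl ⟨D, hD, rfl⟩
    · exact Or.inr ⟨D, hD, rfl⟩

theorem mergeParts_subset_or {C : Finset V} (hC : C ∈ mergeParts G S Z Y) :
    C ⊆ mergeL G S Y ∨ C ⊆ mergeR G S Y := by
  obtain ⟨-, D, -, rfl | rfl⟩ := mem_mergeParts.1 hC
  · exact Or.inl Finset.inter_subset_left
  · exact Or.inr Finset.inter_subset_left

theorem exists_mem_mergeParts {v : V} (hv : v ∈ S) : ∃ C ∈ mergeParts G S Z Y, v ∈ C := by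
  obtain ⟨D, hD, hvD⟩ := Z.exists_mem hv
  rcases mem_mergeL_or_mem_mergeR (G := G) (Y := Y) hv with h | h
  · exact ⟨_, mem_mergeParts.2 ⟨Finset.ne_empty_of_mem (Finset.mem_inter.2 ⟨h, hvD⟩), D, hD,
      Or.inl rfl⟩, Finset.mem_inter.2 ⟨h, hvD⟩⟩
  · exact ⟨_, mem_mergeParts.2 ⟨Finset.ne_empty_of_mem (Finset.mem_inter.2 ⟨h, hvD⟩), D, hD,
      Or.inr rfl⟩, Finset.mem_inter.2 ⟨h, hvD⟩⟩

theorem subset_of_mem_mergeParts {C : Finset V} (hC : C ∈ mergeParts G S Z Y) : C ⊆ S := by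
  rcases mergeParts_subset_or hC with h | h
  · exact h.trans mergeL_subset
  · exact h.trans mergeR_subset

theorem pairwiseDisjoint_mergeParts :
    (mergeParts G S Z Y : Set (Finset V)).PairwiseDisjoint id := by
  intro C hC D hD hCD
  refine Finset.disjoint_left.2 fun v hvC hvD => hCD ?_
  obtain ⟨-, C', hC', h⟩ := mem_mergeParts.1 hC
  obtain ⟨-, D', hD', h'⟩ := mem_mergeParts.1 hD
  have hLR : ¬ (v ∈ mergeL G S Y ∧ v ∈ mergeR G S Y) := fun hv =>
    Finset.disjoint_left.1 disjoint_mergeL_mergeR hv.1 hv.2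
  simp only [id] at hvC hvD
  have hCD' : C' = D' := by
    refine Z.eq_of_mem_parts hC' hD' (a := v) ?_ ?_
    · rcases h with rfl | rfl <;> exact (Finset.mem_inter.1 hvC).2
    · rcases h' with rfl | rfl <;> exact (Finset.mem_inter.1 hvD).2
  subst hCD'
  rcases h with rfl | rfl <;> rcases h' with rfl | rfl
  · rfl
  · exact absurd ⟨(Finset.mem_inter.1 hvC).1, (Finset.mem_inter.1 hvD).1⟩ hLR
  · exact absurd ⟨(Finset.mem_inter.1 hvD).1, (Finset.mem_inter.1 hvC).1⟩ hLR
  · rfl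

/-- The merge-phase sub-clusters form a partition of `S`. -/
noncomputable def mergePartition (G : SimpleGraph V) (S : Finset V) (Z : Finpartition S)
    (Y : Finset (Sym2 V)) : Finpartition S where
  parts := mergeParts G S Z Y
  supIndep := Finset.supIndep_iff_pairwiseDisjoint.2 pairwiseDisjoint_mergeParts
  sup_parts := by
    refine le_antisymm (Finset.sup_le fun C hC => subset_of_mem_mergeParts hC) fun v hv => ?_
    obtain ⟨C, hC, hvC⟩ := exists_mem_mergeParts (G := G) (Z := Z) (Y := Y) hv
    exact Finset.le_sup (f := id) hC hvC
  bot_notMem := fun h => (mem_mergeParts.1 h).1 rfl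

theorem biUnion_mergeParts : (mergeParts G S Z Y).biUnion id = S :=
  (mergePartition G S Z Y).biUnion_parts

theorem sum_mergeParts_subset_mergeL (g : V → ℝ) :
    ∑ C ∈ (mergeParts G S Z Y).filter (fun C => C ⊆ mergeL G S Y), ∑ v ∈ C, g v
      = ∑ v ∈ mergeL G S Y, g v := by
  rw [← Finset.sum_biUnion]
  · refine Finset.sum_congr ?_ fun _ _ => rfl
    ext v
    simp only [Finset.mem_biUnion, Finset.mem_filter]
    constructor
    · rintro ⟨C, ⟨-, hC⟩, hv⟩
      exact hC hv
    · intro hv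
      obtain ⟨C, hC, hvC⟩ := exists_mem_mergeParts (G := G) (Z := Z) (Y := Y) (mergeL_subset hv)
      refine ⟨C, ⟨hC, (mergeParts_subset_or hC).resolve_right fun h => ?_⟩, hvC⟩
      exact Finset.disjoint_left.1 disjoint_mergeL_mergeR hv (h hvC)
  · intro C hC D hD hCD
    exact pairwiseDisjoint_mergeParts (Finset.mem_filter.1 hC).1 (Finset.mem_filter.1 hD).1 hCD

theorem adj_avoiding {u : V} {e : G.edgeSet} (hu : u ∈ S) (hue : u ∈ e.1)
    (he : (Sum.inr e : SubV G) ∉ splitNodes G Y) :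
    (inducedOn (subdivision G) (primed G S \ splitNodes G Y)).Adj (Sum.inl u) (Sum.inr e) :=
  (inducedOn_adj _ _ _ _).2 ⟨subdivision_adj.2 ⟨u, e, hue, Or.inl ⟨rfl, rfl⟩⟩,
    Finset.mem_sdiff.2 ⟨inl_mem_primed.2 hu, inl_notMem_splitNodes⟩,
    Finset.mem_sdiff.2 ⟨inr_mem_primed.2 ⟨u, hu, hue⟩, he⟩⟩

/-- The two-step path through the split node avoids `X_Y` and extends the path that puts `v` in `R`.
-/
theorem mem_mergeR_of_adj {u v : V} {h : G.Adj u v} (hu : u ∈ S) (hv : v ∈ mergeR G S Y)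
    (he : (Sum.inr ⟨s(u, v), h⟩ : SubV G) ∉ splitNodes G Y) : u ∈ mergeR G S Y := by
  obtain ⟨hvS, x, hx, hvx⟩ := Finset.mem_filter.1 hv
  refine Finset.mem_filter.2 ⟨hu, x, hx, ?_⟩
  exact (adj_avoiding hu (Sym2.mem_mk_left u v) he).reachable.trans
    ((adj_avoiding hvS (Sym2.mem_mk_right u v) he).reachable.symm.trans hvx)

theorem mem_mergeR_of_boundary {u : V} {e : G.edgeSet} (hu : u ∈ S) (hue : u ∈ e.1)
    (heB : (Sum.inr e : SubV G) ∈ boundaryNodes G S)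
    (he : (Sum.inr e : SubV G) ∉ splitNodes G Y) : u ∈ mergeR G S Y :=
  Finset.mem_filter.2 ⟨hu, _, Finset.mem_sdiff.2 ⟨heB, he⟩, (adj_avoiding hu hue he).reachable⟩

/-- An edge outside `Y` leaving `L` ends in `R` or outside `S`; either way its end in `L` would
reach `X_{B_S} \ X_Y`. -/
theorem boundaryNodes_mergeL_subset : boundaryNodes G (mergeL G S Y) ⊆ splitNodes G Y := by
  intro x hx
  obtain ⟨u, v, h, rfl, hu, hv⟩ := mem_boundaryNodes.1 hx
  by_contra hY
  have huR := (Finset.mem_sdiff.1 hu).2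
  have huS := mergeL_subset hu
  by_cases hvS : v ∈ S
  · exact huR (mem_mergeR_of_adj huS
      ((mem_mergeL_or_mem_mergeR hvS).resolve_left hv) hY)
  · exact huR (mem_mergeR_of_boundary huS (Sym2.mem_mk_left u v)
      (mem_boundaryNodes.2 ⟨u, v, h, rfl, huS, hvS⟩) hY)

/-- An edge leaving `C` leaves `S`, changes the part of `Z`, or stays in one part and passes between
`L` and `R`, which forces it into `Y`. -/
theorem mem_boundaryNodes_mergeParts {C : Finset V} (hC : C ∈ mergeParts G S Z Y) {x : SubV G}
    (hx : x ∈ boundaryNodes G C) : x ∈ splitNodes G (interEdges G Z.parts) ∨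
      x ∈ splitNodes G Y ∨ x ∈ boundaryNodes G S := by
  obtain ⟨u, v, h, rfl, hu, hv⟩ := mem_boundaryNodes.1 hx
  obtain ⟨-, D, hD, hCD⟩ := mem_mergeParts.1 hC
  have huS := subset_of_mem_mergeParts hC hu
  have huD : u ∈ D := by
    rcases hCD with rfl | rfl <;> exact (Finset.mem_inter.1 hu).2
  by_cases hvS : v ∈ S
  · obtain ⟨D', hD', hvD'⟩ := Z.exists_mem hvS
    by_cases hDD : D = D'
    · subst hDD
      refine Or.inr (Or.inl ?_)
      by_contra hY
      rcases hCD with rfl | rfl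
      · have hvR := (mem_mergeL_or_mem_mergeR hvS).resolve_left fun h' =>
          hv (Finset.mem_inter.2 ⟨h', hvD'⟩)
        exact (Finset.mem_sdiff.1 (Finset.mem_inter.1 hu).1).2 (mem_mergeR_of_adj huS hvR hY)
      · have huR := (Finset.mem_inter.1 hu).1
        have hY' : (Sum.inr ⟨s(v, u), h.symm⟩ : SubV G) ∉ splitNodes G Y := by
          intro h'
          refine hY (inr_mem_splitNodes.2 ?_)
          change s(u, v) ∈ Y
          rw [Sym2.eq_swap]
          exact inr_mem_splitNodes.1 h'
        exact hv (Finset.mem_inter.2 ⟨mem_mergeR_of_adj hvS huR hY', hvD'⟩)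
    · exact Or.inl (inr_mem_interEdges hD hD' hDD huD hvD')
  · exact Or.inr (Or.inr (mem_boundaryNodes.2 ⟨u, v, h, rfl, huS, hvS⟩))

theorem mem_boundaryNodes_of_subset_mergeL {C : Finset V} (hC : C ∈ mergeParts G S Z Y)
    (hCL : C ⊆ mergeL G S Y) {x : SubV G} (hx : x ∈ boundaryNodes G C) :
    x ∈ splitNodes G (interEdges G Z.parts) ∨ x ∈ splitNodes G Y := by
  rcases mem_boundaryNodes_mergeParts hC hx with h | h | h
  · exact Or.inl h
  · exact Or.inr h
  · obtain ⟨u, v, hadj, rfl, hu, -⟩ := mem_boundaryNodes.1 hx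
    refine Or.inr ?_
    by_contra hY
    have huL := hCL hu
    exact (Finset.mem_sdiff.1 huL).2
      (mem_mergeR_of_boundary (mergeL_subset huL) (Sym2.mem_mk_left u v) h hY)

/-- From a node of `X_F \ X_Y` incident to `R` one could continue to `X_{B_S}` avoiding `X_Y`,
against separation. -/
theorem IsMergePhase.mem_boundaryNodes_of_subset_mergeR {τ a : ℝ}
    (hM : IsMergePhase G S τ a Z Y) {C : Finset V} (hC : C ∈ mergeParts G S Z Y)
    (hCR : C ⊆ mergeR G S Y) {x : SubV G} (hx : x ∈ boundaryNodes G C) :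
    x ∈ splitNodes G Y ∨ x ∈ boundaryNodes G S := by
  rcases mem_boundaryNodes_mergeParts hC hx with hF | h | h
  · refine Or.inl ?_
    by_contra hY
    obtain ⟨u, v, hadj, rfl, hu, -⟩ := mem_boundaryNodes.1 hx
    obtain ⟨huS, b, hb, hub⟩ := Finset.mem_filter.1 (hCR hu)
    have hadj' := adj_avoiding huS (e := ⟨s(u, v), hadj⟩) (Sym2.mem_mk_left u v) hY
    obtain ⟨p⟩ := hadj'.reachable.symm.trans hub
    have hle : inducedOn (subdivision G) (primed G S \ splitNodes G Y) ≤ clusterGraph G S := by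
      intro x y hxy
      rw [inducedOn_adj] at hxy
      exact (inducedOn_adj _ _ _ _).2 ⟨hxy.1, (Finset.mem_sdiff.1 hxy.2.1).1,
        (Finset.mem_sdiff.1 hxy.2.2).1⟩
    obtain ⟨y, hyY, hyp⟩ := hM.separates _ hF b (Finset.mem_sdiff.1 hb).1 (p.mapLe hle)
    rw [SimpleGraph.Walk.support_mapLe_eq_support] at hyp
    have := support_subset_inducedOn p ((inducedOn_adj _ _ _ _).1 hadj').2.2 y hyp
    exact (Finset.mem_sdiff.1 this).2 hyY
  · exact Or.inl h
  · exact Or.inr h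

end Merge

end Structure

end TreeCut

namespace TreeCut

/-! ### Moving demand through the refinement phase and the merge phase. -/

section Phases

variable {V : Type*} [Fintype V] {K : Type*} [Fintype K] {G : SimpleGraph V}

theorem Invariant.sum_univ {P : V → K → ℝ} {S : Finset V} {α : ℝ} {PS : SubV G → K → ℝ}
    (h : Invariant G P S α PS) (k : K) : ∑ x, PS x k = ∑ v ∈ S, P v k := by
  rw [← h.total k]
  refine (Finset.sum_subset (Finset.subset_univ _) fun x _ hx => ?_).symm
  exact h.supported k x fun hx' => hx (boundaryNodes_subset_primed S hx')

theorem Invariant.sum_abs_le {P : V → K → ℝ} {S : Finset V} {α : ℝ} {PS : SubV G → K → ℝ}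
    (h : Invariant G P S α PS) (hα : 0 ≤ α) (x : SubV G) : ∑ k, |PS x k| ≤ α := by
  by_cases hx : x ∈ primed G S
  · exact h.load x hx
  · rw [Finset.sum_eq_zero fun k _ => ?_]
    · exact hα
    · rw [h.supported k x fun hx' => hx (boundaryNodes_subset_primed S hx'), abs_zero]

theorem invariant_of_sum_univ {P : V → K → ℝ} {S : Finset V} {α : ℝ} {PS : SubV G → K → ℝ}
    (hsupp : ∀ x ∉ boundaryNodes G S, ∀ k, PS x k = 0) (hload : ∀ x, ∑ k, |PS x k| ≤ α)
    (htot : ∀ k, ∑ x, PS x k = ∑ v ∈ S, P v k) : Invariant G P S α PS where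
  supported k x hx := hsupp x hx k
  total k := by
    rw [← htot k]
    refine Finset.sum_subset (Finset.subset_univ _) fun x _ hx => ?_
    exact hsupp x (fun hx' => hx (boundaryNodes_subset_primed S hx')) k
  load x _ := hload x

/-- The demand states on the refinement-phase parts of `S` can be moved to the boundary of `S`:
first spread the demand of every part over its boundary, then follow the flow. -/
theorem IsRefinementPhase.exists_state {S : Finset V} {cf σ a b d : ℝ} {W : Finpartition S}
    (h : IsRefinementPhase G S cf σ a b d W) (hb : 0 ≤ b)
    (hγ : ∀ D ∈ W.parts, 0 < a / (fRef V cf σ D * Real.logb 2 (Fintype.card V)))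
    {T : Finset (Finset V)} (hT : IsHierarchy T) {P : V → K → ℝ} (hP : TreeRespects G T 1 P)
    (hWT : ∀ D ∈ W.parts, D ∈ T) {α : ℝ} (hα : 0 ≤ α) {PS : Finset V → SubV G → K → ℝ}
    (hPS : ∀ D ∈ W.parts, Invariant G P D α (PS D)) :
    ∃ D' : SubV G → K → ℝ, (∀ x ∉ boundaryNodes G S, ∀ k, D' x k = 0) ∧
      (∀ x, ∑ k, |D' x k| ≤ 2 * (b + 1)) ∧ (∀ k, ∑ x, D' x k = ∑ v ∈ S, P v k) ∧
      ∀ A, stateDem ((∑ D ∈ W.parts, PS D) - D') A ≤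
        ∑ D ∈ W.parts, α * (a / (fRef V cf σ D * Real.logb 2 (Fintype.card V)))⁻¹ *
          cutCap (clusterGraph G D) A +
        2 * (d * Real.logb 2 (Fintype.card V)) * cutCap (clusterGraph G S) A := by
  set M : Finset V → SubV G → K → ℝ :=
    fun D => spreadState (fun k => ∑ x, PS D x k) (boundaryNodes G D) with hM
  have hM0 : ∀ D ∈ W.parts, ∀ x ∉ boundaryNodes G D, ∀ k, M D x k = 0 := by
    intro D _ x hx k
    simp [hM, spreadState, hx]
  -- The invariant turns the total into that of `P` on `D`, which the tree bounds by the boundary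
  -- size. Here the load drops from `α` to 1.
  have hMq : ∀ D ∈ W.parts, ∑ k, |∑ x, PS D x k| ≤ 1 * (boundaryNodes G D).card := by
    intro D hD
    simp only [(hPS D hD).sum_univ]
    rw [card_boundaryNodes, one_mul]
    exact hP.sum_abs_le hT (hWT D hD)
  have hMl : ∀ D ∈ W.parts, ∀ x, ∑ k, |M D x k| ≤ 1 :=
    fun D hD x => sum_abs_spreadState_le zero_le_one (hMq D hD) x
  have hMt : ∀ D ∈ W.parts, ∀ k, ∑ x, M D x k = ∑ v ∈ D, P v k := by
    intro D hD k
    rw [← (hPS D hD).sum_univ]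
    refine sum_spreadState (fun h0 k => Finset.sum_eq_zero fun x _ => ?_) k
    exact (hPS D hD).supported k x (by rw [h0]; exact Finset.notMem_empty x)
  have hdis : (W.parts : Set (Finset V)).PairwiseDisjoint id := W.disjoint
  have hsl : ∀ x, ∑ k, |(∑ D ∈ W.parts, M D) x k| ≤ 2 * 1 := by
    intro x
    simp only [Finset.sum_apply]
    exact sum_abs_sum_boundary_le hdis zero_le_one hM0 hMl x
  have hs0 : ∀ x, x ∉ splitNodes G (interEdges G W.parts) → x ∉ boundaryNodes G S →
      ∀ k, (∑ D ∈ W.parts, M D) x k = 0 := by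
    intro x hx hxS k
    simp only [Finset.sum_apply]
    refine Finset.sum_eq_zero fun D hD => hM0 D hD x (fun hxD => ?_) k
    exact (mem_boundaryNodes_part W hD hxD).elim hx hxS
  obtain ⟨D', h0, hl, ht, hd⟩ :=
    h.flow.exists_state (fun _ => rfl) hb hs0 (by norm_num) hsl
  refine ⟨D', h0, fun x => by simpa using hl x, fun k => ?_, fun A => ?_⟩
  · rw [ht k]
    simp only [Finset.sum_apply]
    rw [Finset.sum_comm, Finset.sum_congr rfl fun D hD => hMt D hD k]
    exact (Finset.sum_biUnion hdis (f := fun v => P v k)).symm.trans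
      (by rw [W.biUnion_parts])
  · have h1 := stateDem_sub_le_add (∑ D ∈ W.parts, PS D) (∑ D ∈ W.parts, M D) D' A
    have h2 : stateDem ((∑ D ∈ W.parts, PS D) - ∑ D ∈ W.parts, M D) A ≤
        ∑ D ∈ W.parts, α * (a / (fRef V cf σ D * Real.logb 2 (Fintype.card V)))⁻¹ *
          cutCap (clusterGraph G D) A := by
      rw [← Finset.sum_sub_distrib]
      refine (stateDem_sum_le _ _ A).trans (Finset.sum_le_sum fun D hD => ?_)
      exact (h.respects D hD).stateDem_sub_spread_le (hγ D hD) hα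
        (fun x hx k => (hPS D hD).supported k x hx) ((hPS D hD).sum_abs_le hα) A
    have h3 := hd A
    linarith

/-- The demand states on the boundaries of the merge-phase sub-clusters of `S` can be moved to
the boundary of `S`: the demand inside the core `L` is moved to `Y` through the expansion and the
reversed flow from `Y`, and the demand on `Y` follows the flow to the boundary. -/
theorem IsMergePhase.exists_state {S : Finset V} {a : ℝ} {Z : Finpartition S}
    {Y : Finset (Sym2 V)} (h : IsMergePhase G S 1 a Z Y)
    (hγ : 0 < a / Real.logb 2 (Fintype.card V)) {T : Finset (Finset V)} (hT : IsHierarchy T)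
    {P : V → K → ℝ} (hP : TreeRespects G T 1 P)
    (hLT : (mergeL G S Y).Nonempty → mergeL G S Y ∈ T) {c : ℝ} (hc : 0 ≤ c)
    {D : Finset V → SubV G → K → ℝ}
    (hD0 : ∀ C ∈ mergeParts G S Z Y, ∀ x ∉ boundaryNodes G C, ∀ k, D C x k = 0)
    (hDl : ∀ C ∈ mergeParts G S Z Y, ∀ x, ∑ k, |D C x k| ≤ c)
    (hDt : ∀ C ∈ mergeParts G S Z Y, ∀ k, ∑ x, D C x k = ∑ v ∈ C, P v k) :
    ∃ D' : SubV G → K → ℝ, (∀ x ∉ boundaryNodes G S, ∀ k, D' x k = 0) ∧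
      (∀ x, ∑ k, |D' x k| ≤ 3 * (4 * c + 1)) ∧ (∀ k, ∑ x, D' x k = ∑ v ∈ S, P v k) ∧
      ∀ A, stateDem ((∑ C ∈ mergeParts G S Z Y, D C) - D') A ≤
        (12 * c + 4 + (8 * c + 3) * (a / Real.logb 2 (Fintype.card V))⁻¹) *
          cutCap (clusterGraph G S) A := by
  have hmu : ∀ x, muTau G S 1 x = 1 := fun x => by simp [muTau]
  set XF := splitNodes G (interEdges G Z.parts) with hXF
  set XY := splitNodes G Y with hXY
  set E : SubV G → K → ℝ := ∑ C ∈ mergeParts G S Z Y, D C with hE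
  have hEa : ∀ x k, E x k = ∑ C ∈ mergeParts G S Z Y, D C x k := fun x k => by
    simp only [hE, Finset.sum_apply]
  have hEl : ∀ x, ∑ k, |E x k| ≤ 2 * c := by
    intro x
    simp only [hEa]
    exact sum_abs_sum_boundary_le pairwiseDisjoint_mergeParts hc hD0 hDl x
  have hEt : ∀ k, ∑ x, E x k = ∑ v ∈ S, P v k := by
    intro k
    simp only [hEa]
    rw [Finset.sum_comm, Finset.sum_congr rfl fun C hC => hDt C hC k]
    exact (Finset.sum_biUnion pairwiseDisjoint_mergeParts (f := fun v => P v k)).symm.trans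
      (by rw [biUnion_mergeParts])
  -- The part of `E` that cannot directly use the flow to the boundary; `q` is its total per
  -- commodity.
  set EF : SubV G → K → ℝ := restrictState E (XF \ XY) with hEF
  set q : K → ℝ := fun k => ∑ x, EF x k with hq
  set PL := (mergeParts G S Z Y).filter (fun C => C ⊆ mergeL G S Y) with hPL
  -- only sub-clusters of the core have demand on `XF \ XY`
  have hEFL : ∀ x ∈ XF \ XY, ∀ k, E x k = ∑ C ∈ PL, D C x k := by
    intro x hx k
    rw [hEa, hPL, Finset.sum_filter]
    refine Finset.sum_congr rfl fun C hC => ?_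
    split_ifs with hCL
    · rfl
    · refine hD0 C hC x (fun hxC => ?_) k
      rw [Finset.mem_sdiff] at hx
      rcases h.mem_boundaryNodes_of_subset_mergeR hC ((mergeParts_subset_or hC).resolve_left hCL)
        hxC with h' | h'
      · exact hx.2 h'
      -- Impossible: an edge between parts of `Z` has both ends in `S`.
      · obtain ⟨u, v, hadj, rfl, hu, hv⟩ := mem_boundaryNodes.1 h'
        obtain ⟨-, C1, hC1, C2, hC2, -, u', hu', v', hv', he⟩ :=
          Finset.mem_filter.1 (inr_mem_splitNodes.1 hx.1)
        rcases Sym2.eq_iff.1 he with ⟨-, rfl⟩ | ⟨-, rfl⟩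
        · exact hv (Z.le hC2 hv')
        · exact hv (Z.le hC1 hu')
  -- The sub-clusters in `L` have total demand `P(L)`, all of it on `XF ∪ XY`; removing what sits on
  -- `XY` leaves `q`.
  have hqeq : ∀ k, q k = ∑ v ∈ mergeL G S Y, P v k - ∑ x ∈ XY, ∑ C ∈ PL, D C x k := by
    intro k
    have h1 : ∑ v ∈ mergeL G S Y, P v k = ∑ x, ∑ C ∈ PL, D C x k := by
      rw [← sum_mergeParts_subset_mergeL (G := G) (Z := Z), Finset.sum_comm]
      exact Finset.sum_congr rfl fun C hC => (hDt C (Finset.mem_filter.1 hC).1 k).symm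
    rw [h1, eq_sub_iff_add_eq, ← Finset.sum_filter_add_sum_filter_not Finset.univ (· ∈ XY),
      Finset.filter_univ_mem, add_comm, hq]
    congr 1
    rw [Finset.sum_filter]
    refine Finset.sum_congr rfl fun x _ => ?_
    by_cases hxY : x ∈ XY
    · simp [hEF, restrictState, hxY]
    · by_cases hxF : x ∈ XF
      · simp only [hEF, restrictState, Finset.mem_sdiff, hxF, hxY, not_false_eq_true, and_self,
          if_true]
        exact hEFL x (Finset.mem_sdiff.2 ⟨hxF, hxY⟩) k
      · simp only [hEF, restrictState, Finset.mem_sdiff, hxF, hxY, not_false_eq_true, false_and,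
          if_false, if_true]
        refine (Finset.sum_eq_zero fun C hC => ?_).symm
        obtain ⟨hC, hCL⟩ := Finset.mem_filter.1 hC
        refine hD0 C hC x (fun hxC => ?_) k
        exact (mem_boundaryNodes_of_subset_mergeL hC hCL hxC).elim hxF hxY
  have hPLl : ∀ x, ∑ k, |∑ C ∈ PL, D C x k| ≤ 2 * c :=
    sum_abs_sum_boundary_le
      (pairwiseDisjoint_mergeParts.subset (by exact_mod_cast Finset.filter_subset _ _)) hc
      (fun C hC => hD0 C (Finset.mem_filter.1 hC).1)
      (fun C hC => hDl C (Finset.mem_filter.1 hC).1)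
  -- The `1` comes from the tree bound for `L`, whose boundary lies in `XY`; the `2 * c` is the load
  -- of these sub-clusters on `XY`.
  have hqn : ∑ k, |q k| ≤ (2 * c + 1) * XY.card := by
    simp only [hqeq]
    refine (sum_abs_sub_le _ _).trans ?_
    have h1 : ∑ k, |∑ v ∈ mergeL G S Y, P v k| ≤ XY.card := by
      rcases (mergeL G S Y).eq_empty_or_nonempty with h0 | h0
      · simp [h0]
      · refine (hP.sum_abs_le hT (hLT h0)).trans ?_
        rw [← card_boundaryNodes]
        exact_mod_cast Finset.card_le_card boundaryNodes_mergeL_subset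
    have h2 : ∑ k, |∑ x ∈ XY, ∑ C ∈ PL, D C x k| ≤ XY.card * (2 * c) := by
      refine (sum_abs_sum_le _ _).trans ((Finset.sum_le_sum fun x _ => hPLl x).trans ?_)
      rw [Finset.sum_const, nsmul_eq_mul]
    linarith
  have hq0 : XY = ∅ → ∀ k, q k = 0 := by
    intro h0 k
    rw [h0, Finset.card_empty, Nat.cast_zero, mul_zero] at hqn
    have := (Finset.single_le_sum (f := fun k => |q k|) (fun _ _ => abs_nonneg _)
      (Finset.mem_univ k)).trans hqn
    exact abs_eq_zero.1 (le_antisymm this (abs_nonneg _))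
  set M : SubV G → K → ℝ := spreadState q XY with hM
  have hM0 : ∀ x ∉ XY, ∀ k, M x k = 0 := fun x hx k => by simp [hM, spreadState, hx]
  have hMl : ∀ x, ∑ k, |M x k| ≤ 2 * c + 1 := sum_abs_spreadState_le (by linarith) hqn
  have hMt : ∀ k, ∑ x, M x k = q k := sum_spreadState hq0
  -- `I` is where the flow would carry `M` on `XF`. It has the same totals as `EF`, so `EF - I` is
  -- valid and expansion bounds its cost; going from `I` back to `M` costs the same as from `M` to
  -- `I`.
  obtain ⟨I, hI0, hIl, hIt, hId⟩ := h.flow_to_inter.exists_state hmu (by norm_num)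
    (fun x hx _ => hM0 x hx) (by linarith) hMl
  have hEFl : ∀ x, ∑ k, |EF x k| ≤ 2 * c := sum_abs_restrictState_le hEl _
  have hdl : ∀ x, ∑ k, |(EF - I) x k| ≤ 8 * c + 3 := by
    intro x
    have h1 := sum_abs_sub_le (EF x) (I x)
    have h2 := hEFl x
    have h3 := hIl x
    simp only [Pi.sub_apply]
    linarith
  have hd0 : ∀ x ∉ XF, ∀ k, (EF - I) x k = 0 := by
    intro x hx k
    simp [hEF, restrictState, hx, hI0 x hx k]
  have hdv : ValidState (EF - I) := by
    intro k
    simp only [Pi.sub_apply, Finset.sum_sub_distrib]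
    rw [hIt k, hMt k, sub_self]
  have hexp := h.expands.stateDem_le hγ (by linarith) hd0 hdl hdv
  have hR0 : ∀ x, x ∉ XY → x ∉ boundaryNodes G S → ∀ k, (E - EF + M) x k = 0 := by
    intro x hxY hxS k
    simp only [Pi.add_apply, Pi.sub_apply, hM0 x hxY, add_zero]
    by_cases hxF : x ∈ XF
    · simp [hEF, restrictState, hxF, hxY]
    · have h1 : E x k = 0 := by
        rw [hEa]
        refine Finset.sum_eq_zero fun C hC => hD0 C hC x (fun hxC => ?_) k
        rcases mem_boundaryNodes_mergeParts hC hxC with h' | h' | h'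
        exacts [hxF h', hxY h', hxS h']
      simp [hEF, restrictState, hxF, h1]
  have hRl : ∀ x, ∑ k, |(E - EF + M) x k| ≤ 4 * c + 1 := by
    intro x
    have h1 := sum_abs_add_le ((E - EF) x) (M x)
    have h2 : ∑ k, |(E - EF) x k| ≤ 2 * c := sum_abs_sub_restrictState_le hEl _ x
    have h3 := hMl x
    simp only [Pi.add_apply]
    linarith
  obtain ⟨D', hD'0, hD'l, hD't, hD'd⟩ := h.flow_to_boundary.exists_state hmu (by norm_num) hR0
    (by linarith) hRl
  refine ⟨D', hD'0, fun x => (hD'l x).trans (le_of_eq (by ring)), fun k => ?_, fun A => ?_⟩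
  · rw [hD't k]
    simp only [Pi.add_apply, Pi.sub_apply, Finset.sum_add_distrib, Finset.sum_sub_distrib]
    rw [hMt k, hEt k]
    simp only [hq, sub_add_cancel]
  · have h1 := stateDem_sub_le_add E (E - EF + M) D' A
    have h2 := stateDem_sub_le_add EF I M A
    have h3 : E - (E - EF + M) = EF - M := by abel
    rw [h3] at h1
    have h4 := hexp A
    have h5 := hId A
    rw [stateDem_sub_comm] at h5
    have h6 := hD'd A
    have h7 : (8 * c + 3) * (a / Real.logb 2 (Fintype.card V))⁻¹ *
        cutCap (innerClusterGraph G S) A ≤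
        (8 * c + 3) * (a / Real.logb 2 (Fintype.card V))⁻¹ * cutCap (clusterGraph G S) A := by
      have : (0 : ℝ) ≤ (a / Real.logb 2 (Fintype.card V))⁻¹ := inv_nonneg.2 hγ.le
      exact mul_le_mul_of_nonneg_left (cutCap_mono (innerClusterGraph_le S) A) (by positivity)
    linarith

end Phases

end TreeCut

namespace TreeCut

/-! ### Lower bound on `f`, the two-vertex case, and assembly of the charges. -/

section Main

variable {V : Type*} [Fintype V] {K : Type*} [Fintype K] {G : SimpleGraph V}

/-- A part of `Z` has at least one vertex and at most two thirds of those of `S`. -/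
theorem IsMergePhase.two_le_card {S : Finset V} {τ a : ℝ} {Z : Finpartition S}
    {Y : Finset (Sym2 V)} (h : IsMergePhase G S τ a Z Y) (hS : S.Nonempty) : 2 ≤ S.card := by
  obtain ⟨v, hv⟩ := hS
  obtain ⟨C, hC, hvC⟩ := Z.exists_mem hv
  have h1 := h.card_le C hC
  have h2 : (1 : ℝ) ≤ C.card := by exact_mod_cast Finset.card_pos.2 ⟨v, hvC⟩
  have h3 : (1 : ℝ) < S.card := by linarith
  exact_mod_cast h3

theorem IsMergePhase.card_mergeParts_le {S : Finset V} {τ a : ℝ} {Z : Finpartition S}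
    {Y : Finset (Sym2 V)} (h : IsMergePhase G S τ a Z Y) {C : Finset V}
    (hC : C ∈ mergeParts G S Z Y) : (C.card : ℝ) ≤ 2 / 3 * (S.card : ℝ) := by
  obtain ⟨-, D, hD, hCD⟩ := mem_mergeParts.1 hC
  refine le_trans ?_ (h.card_le D hD)
  have : C ⊆ D := by rcases hCD with rfl | rfl <;> exact Finset.inter_subset_right
  exact_mod_cast Finset.card_le_card this

theorem one_lt_logb_three : 1 < Real.logb 2 3 := by
  rw [Real.lt_logb_iff_rpow_lt (by norm_num) (by norm_num)]
  norm_num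

/-- A lower bound on `f(D)` for clusters `D` of size at most `2σ/3`. -/
theorem le_fRef {cf σ : ℝ} {D : Finset V} (hcf : 1 ≤ cf) (hD : D.Nonempty)
    (hDσ : (D.card : ℝ) ≤ 2 / 3 * σ) (hn : 3 ≤ Fintype.card V) :
    Real.logb 2 (3 / 2) * Real.logb 2 (Real.logb 2 3) ≤ fRef V cf σ D := by
  have hD0 : (0 : ℝ) < D.card := by exact_mod_cast hD.card_pos
  have hn' : (3 : ℝ) ≤ Fintype.card V := by exact_mod_cast hn
  have h3 := one_lt_logb_three
  have e1 : 0 < Real.logb 2 (3 / 2) := Real.logb_pos (by norm_num) (by norm_num)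
  have e2 : 0 < Real.logb 2 (Real.logb 2 3) := Real.logb_pos (by norm_num) h3
  have h1 : Real.logb 2 (3 / 2) ≤ Real.logb 2 (σ / D.card) := by
    refine Real.logb_le_logb_of_le (by norm_num) (by norm_num) ?_
    rw [le_div_iff₀ hD0]
    linarith
  have h2 : Real.logb 2 (Real.logb 2 3) ≤ Real.logb 2 (Real.logb 2 (Fintype.card V)) :=
    Real.logb_le_logb_of_le (by norm_num) (by linarith)
      (Real.logb_le_logb_of_le (by norm_num) (by norm_num) hn')
  unfold fRef
  have h4 : Real.logb 2 (3 / 2) ≤ cf * Real.logb 2 (σ / D.card) := by nlinarith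
  exact mul_le_mul h4 h2 e2.le (e1.le.trans h4)

/-- With at most one split node, the entry there equals the total, which is zero. -/
theorem eq_zero_of_supported_of_subsingleton [Subsingleton G.edgeSet] {D : SubV G → K → ℝ}
    (h0 : ∀ v k, D (Sum.inl v) k = 0) (hD : ValidState D) : D = 0 := by
  funext x k
  rcases x with v | e
  · exact h0 v k
  · have h1 := hD k
    rw [Fintype.sum_sum_type, Finset.sum_eq_zero fun v _ => h0 v k, zero_add,
      Fintype.sum_subsingleton _ e] at h1
    exact h1

theorem subsingleton_edgeSet (h : Fintype.card V ≤ 2) : Subsingleton G.edgeSet := by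
  rw [← Finite.card_le_one_iff_subsingleton, Nat.card_eq_fintype_card,
    ← SimpleGraph.edgeFinset_card]
  refine G.card_edgeFinset_le_card_choose_two.trans ?_
  have : (Fintype.card V).choose 2 ≤ Nat.choose 2 2 := Nat.choose_le_choose 2 h
  simpa using this

end Main

end TreeCut
theorem mainTheorem5 (a₁ a₂ b d : ℝ) (ha₁ : 0 < a₁) (ha₂ : 0 < a₂) (hb : 0 < b) (hd : 0 < d) :
    ∃ α' C : ℝ, 1 ≤ α' ∧ 0 < C ∧
      ∀ (V : Type*) (K : Type*) [Fintype V] [Fintype K] (G : SimpleGraph V) (cf : ℝ), 1 ≤ cf →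
      -- the decomposition tree and the demand state
      ∀ T : Finset (Finset V), IsHierarchy T →
      ∀ P : V → K → ℝ, ValidState P → TreeRespects G T 1 P →
      -- the cluster, its merge-phase partition, and their refinement-phase partitions
      ∀ (S : Finset V) (Z : Finpartition S) (Y : Finset (Sym2 V)), IsMergePhase G S 1 a₁ Z Y →
      ∀ W : (Si : Finset V) → Finpartition Si,
      (∀ Si ∈ mergeParts G S Z Y, IsRefinementPhase G Si cf S.card a₂ b d (W Si)) →
      -- all these clusters are nodes of the decomposition tree
      S ∈ T →
      ((mergeL G S Y).Nonempty → mergeL G S Y ∈ T) →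
      ((mergeR G S Y).Nonempty → mergeR G S Y ∈ T) →
      (∀ Si ∈ mergeParts G S Z Y, Si ∈ T ∧ ∀ Sij ∈ (W Si).parts, Sij ∈ T) →
      -- the given demand states on the sub-clusters
      ∀ α : ℝ, 1 ≤ α → ∀ PS : Finset V → SubV G → K → ℝ,
      (∀ Si ∈ mergeParts G S Z Y, ∀ Sij ∈ (W Si).parts, Invariant G P Sij α (PS Sij)) →
      ∃ Pafter : SubV G → K → ℝ,
        Invariant G P S α' Pafter ∧
        ∀ B : Finset V, ∃ charge : Sym2 (SubV G) → ℝ,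
          (∀ e, 0 ≤ charge e) ∧
          stateDem ((∑ Si ∈ mergeParts G S Z Y, ∑ Sij ∈ (W Si).parts, PS Sij) - Pafter)
              (primed G B) ≤
            ∑ e ∈ cutEdges (clusterGraph G S) (primed G B), charge e ∧
          ∀ Si ∈ mergeParts G S Z Y, ∀ Sij ∈ (W Si).parts,
            ∀ e ∈ cutEdges (clusterGraph G Sij) (primed G B),
              charge e ≤ C * α * Real.logb 2 (Fintype.card V) * fRef V cf S.card Sij := by
  
  have hδ : 0 < Real.logb 2 (3 / 2) * Real.logb 2 (Real.logb 2 3) :=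
    mul_pos (Real.logb_pos (by norm_num) (by norm_num))
      (Real.logb_pos (by norm_num) one_lt_logb_three)
  set δ := Real.logb 2 (3 / 2) * Real.logb 2 (Real.logb 2 3) with hδ_def
  -- `δ` bounds `f` from below, `c` is the load after the refinement phase, and `m * log n` bounds
  -- the merge-phase cost per edge. None involves `α`.
  set c : ℝ := 2 * (b + 1) with hc_def
  have hc : 0 < c := by positivity
  set m : ℝ := 12 * c + 4 + (8 * c + 3) / a₁ with hm_def
  have hm : 0 < m := by positivity
  refine ⟨3 * (4 * c + 1), a₂⁻¹ + (2 * d + m) / δ, by linarith, by positivity, ?_⟩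
  intro V K _ _ G cf hcf T hT P hP hPT S Z Y hM W hW hST hLT hRT hWT α hα PS hPS
  have hS2 := hM.two_le_card (hT.nonempty S hST)
  have hSn : S.card ≤ Fintype.card V := Finset.card_le_univ S
  have htot : ∀ k, ∑ x, (∑ Si ∈ mergeParts G S Z Y, ∑ Sij ∈ (W Si).parts, PS Sij) x k
      = ∑ v ∈ S, P v k := by
    intro k
    simp only [Finset.sum_apply]
    rw [Finset.sum_comm]
    refine Eq.trans ?_ ((Finset.sum_biUnion pairwiseDisjoint_mergeParts
      (f := fun v => P v k)).symm.trans (by rw [biUnion_mergeParts (G := G) (Z := Z) (Y := Y)]))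
    refine Finset.sum_congr rfl fun Si hSi => ?_
    rw [Finset.sum_comm]
    refine Eq.trans ?_ ((Finset.sum_biUnion (W Si).disjoint
      (f := fun v => P v k)).symm.trans (by rw [(W Si).biUnion_parts, id]))
    exact Finset.sum_congr rfl fun Sij hSij => (hPS Si hSi Sij hSij).sum_univ k
  -- For `n = 2`, `log log n = 0` allows only zero charges; but `S` is all of `V` and there is at
  -- most one edge, so validity of `P` kills the demand.
  rcases lt_or_ge (Fintype.card V) 3 with hn | hn
  · have hn2 : Fintype.card V = 2 := by omega
    have hSu : S = Finset.univ := Finset.eq_univ_of_card S (by omega)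
    have := subsingleton_edgeSet (G := G) hn2.le
    have hz : (∑ Si ∈ mergeParts G S Z Y, ∑ Sij ∈ (W Si).parts, PS Sij) = 0 := by
      refine eq_zero_of_supported_of_subsingleton (fun v k => ?_) (fun k => ?_)
      · simp only [Finset.sum_apply]
        exact Finset.sum_eq_zero fun Si hSi => Finset.sum_eq_zero fun Sij hSij =>
          (hPS Si hSi Sij hSij).supported k _ inl_notMem_splitNodes
      · rw [htot, hSu, hP k]
    refine ⟨0, invariant_of_sum_univ (fun _ _ _ => rfl) (fun x => ?_) (fun k => ?_), fun B =>
      ⟨0, fun _ => le_rfl, ?_, fun Si _ Sij _ e _ => ?_⟩⟩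
    · simp only [Pi.zero_apply, abs_zero, Finset.sum_const_zero]
      positivity
    · rw [hSu, hP k]
      simp
    · rw [hz]
      simp [stateDem]
    · simp [fRef, hn2]
  · set L := Real.logb 2 (Fintype.card V) with hL_def
    have hL : 1 ≤ L := one_lt_logb_three.le.trans
      (Real.logb_le_logb_of_le (by norm_num) (by norm_num) (by exact_mod_cast hn))
    have hL0 : 0 < L := by linarith
    have hf : ∀ Si ∈ mergeParts G S Z Y, ∀ Sij ∈ (W Si).parts, δ ≤ fRef V cf S.card Sij := by
      intro Si hSi Sij hSij
      refine le_fRef hcf ((W Si).nonempty_of_mem_parts hSij) ?_ hn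
      refine le_trans ?_ (hM.card_mergeParts_le hSi)
      exact_mod_cast Finset.card_le_card ((W Si).le hSij)
    -- Membership sits inside the existential so that `choose` gives a function on all finsets.
    have hstep : ∀ Si, ∃ D' : SubV G → K → ℝ, Si ∈ mergeParts G S Z Y →
        (∀ x ∉ boundaryNodes G Si, ∀ k, D' x k = 0) ∧ (∀ x, ∑ k, |D' x k| ≤ c) ∧
        (∀ k, ∑ x, D' x k = ∑ v ∈ Si, P v k) ∧
        ∀ A, stateDem ((∑ Sij ∈ (W Si).parts, PS Sij) - D') A ≤
          ∑ Sij ∈ (W Si).parts, α * (a₂ / (fRef V cf S.card Sij * L))⁻¹ *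
            cutCap (clusterGraph G Sij) A + 2 * (d * L) * cutCap (clusterGraph G Si) A := by
      intro Si
      by_cases hSi : Si ∈ mergeParts G S Z Y
      · obtain ⟨D', hD'⟩ := (hW Si hSi).exists_state hb.le
          (fun Sij hSij => div_pos ha₂ (mul_pos (hδ.trans_le (hf Si hSi Sij hSij)) hL0))
          hT hPT (hWT Si hSi).2 (by linarith : (0 : ℝ) ≤ α) (hPS Si hSi)
        exact ⟨D', fun _ => hD'⟩
      · exact ⟨0, fun h => absurd h hSi⟩
    choose D hD using hstep
    obtain ⟨D', hD'0, hD'l, hD't, hD'd⟩ := hM.exists_state (div_pos ha₁ hL0) hT hPT hLT hc.le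
      (fun C hC => (hD C hC).1) (fun C hC => (hD C hC).2.1) (fun C hC => (hD C hC).2.2.1)
    refine ⟨D', invariant_of_sum_univ hD'0 hD'l hD't, fun B => ?_⟩
    -- The three summands pay for spreading, the refinement flow and the merge phase.
    set κ : Finset V → ℝ := fun Sij =>
      α * (a₂ / (fRef V cf S.card Sij * L))⁻¹ + 2 * (d * L) + m * L with hκ_def
    set 𝒟 : Set (Finset V) := {Sij | ∃ Si ∈ mergeParts G S Z Y, Sij ∈ (W Si).parts} with h𝒟_def
    have h𝒟 : 𝒟.PairwiseDisjoint id := by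
      rintro C ⟨Si, hSi, hC⟩ C' ⟨Si', hSi', hC'⟩ hCC'
      by_cases hSS : Si = Si'
      · subst hSS
        exact (W Si).disjoint hC hC' hCC'
      · exact Disjoint.mono ((W Si).le hC) ((W Si').le hC')
          (pairwiseDisjoint_mergeParts hSi hSi' hSS)
    have hκ0 : ∀ C ∈ 𝒟, 0 ≤ κ C := by
      rintro C ⟨Si, hSi, hC⟩
      have := hδ.trans_le (hf Si hSi C hC)
      positivity
    obtain ⟨charge, hch0, hch⟩ := exists_charge (G := G) h𝒟 κ hκ0
    refine ⟨charge, hch0, ?_, fun Si hSi Sij hSij e he => ?_⟩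
    · set A := primed G B with hA
      have hsum : ∑ e ∈ cutEdges (clusterGraph G S) A, charge e
          = ∑ Si ∈ mergeParts G S Z Y, ∑ Sij ∈ (W Si).parts,
              κ Sij * cutCap (clusterGraph G Sij) A := by
        rw [sum_cutEdges_clusterGraph (mergePartition G S Z Y)]
        refine Finset.sum_congr rfl fun Si hSi => ?_
        rw [sum_cutEdges_clusterGraph (W Si)]
        refine Finset.sum_congr rfl fun Sij hSij => ?_
        rw [Finset.sum_congr rfl fun e he => hch Sij ⟨Si, hSi, hSij⟩ e
          (mem_edgeSet_of_mem_cutEdges he), Finset.sum_const, nsmul_eq_mul, mul_comm]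
        rfl
      have h1 := stateDem_sub_le_add (∑ Si ∈ mergeParts G S Z Y, ∑ Sij ∈ (W Si).parts, PS Sij)
        (∑ Si ∈ mergeParts G S Z Y, D Si) D' A
      have h2 : stateDem ((∑ Si ∈ mergeParts G S Z Y, ∑ Sij ∈ (W Si).parts, PS Sij)
            - ∑ Si ∈ mergeParts G S Z Y, D Si) A
          ≤ ∑ Si ∈ mergeParts G S Z Y, ∑ Sij ∈ (W Si).parts,
              (α * (a₂ / (fRef V cf S.card Sij * L))⁻¹ + 2 * (d * L)) *
                cutCap (clusterGraph G Sij) A := by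
        rw [← Finset.sum_sub_distrib]
        refine (stateDem_sum_le _ _ A).trans (Finset.sum_le_sum fun Si hSi => ?_)
        refine ((hD Si hSi).2.2.2 A).trans (le_of_eq ?_)
        rw [cutCap_clusterGraph (W Si), Finset.mul_sum, ← Finset.sum_add_distrib]
        exact Finset.sum_congr rfl fun _ _ => (add_mul _ _ _).symm
      have h3 : stateDem ((∑ Si ∈ mergeParts G S Z Y, D Si) - D') A
          ≤ ∑ Si ∈ mergeParts G S Z Y, ∑ Sij ∈ (W Si).parts,
              m * L * cutCap (clusterGraph G Sij) A := by
        refine (hD'd A).trans (le_trans (b := m * L * cutCap (clusterGraph G S) A) ?_ ?_)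
        · refine mul_le_mul_of_nonneg_right ?_ (cutCap_nonneg _ _)
          have e1 : (8 * c + 3) * (L / a₁) = (8 * c + 3) / a₁ * L := by ring
          have e2 : 12 * c + 4 ≤ (12 * c + 4) * L := le_mul_of_one_le_right (by positivity) hL
          rw [inv_div, hm_def, add_mul _ _ L, ← hL_def, e1]
          linarith
        · rw [cutCap_clusterGraph (mergePartition G S Z Y), Finset.mul_sum]
          refine Finset.sum_le_sum fun Si _ => ?_
          rw [cutCap_clusterGraph (W Si), Finset.mul_sum]
      rw [hsum]
      refine h1.trans ((add_le_add h2 h3).trans (le_of_eq ?_))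
      simp only [hκ_def, add_mul, Finset.sum_add_distrib]
    · rw [hch Sij ⟨Si, hSi, hSij⟩ e (mem_edgeSet_of_mem_cutEdges he)]
      have hfS := hf Si hSi Sij hSij
      set F := fRef V cf S.card Sij
      have hF : 0 < F := hδ.trans_le hfS
      -- Absorbs the terms without `α` and `f`, using `α ≥ 1` and `F ≥ δ`.
      have h1 : 1 ≤ α * F / δ := by
        rw [le_div_iff₀ hδ]
        nlinarith
      have h2 := mul_le_mul_of_nonneg_left h1 (by positivity : 0 ≤ (2 * d + m) * L)
      calc κ Sij = α * (F * L / a₂) + (2 * d + m) * L * 1 := by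
            simp only [hκ_def]
            rw [inv_div]
            ring
        _ ≤ α * (F * L / a₂) + (2 * d + m) * L * (α * F / δ) := by linarith
        _ = (a₂⁻¹ + (2 * d + m) / δ) * α * L * F := by
            field_simp
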